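/- Let $d\ge 1$ and $k\ge 1$ be integers and let $0<\epsilon\le 1$. A map $g:\mathbb R\to\mathbb R$ is called $C^{k+\epsilon}$ if it is $C^k$ and its $k$-th derivative is Hölder continuous with exponent $\epsilon$ (Lipschitz if $\epsilon=1$). Let $\Sigma_d=\{1,\dots,d\}^{\mathbb N}$ with the product topology, and for $i\in\{1,\dots,d\}$ and $\alpha=(\alpha_1\alpha_2\dots)\in\Sigma_d$ write $i\alpha=(i\alpha_1\alpha_2\dots)$. Consider topological embeddings $h:\Sigma_d\to\mathbb R$ that respect the lexicographic order, i.e. $h(\alpha)>h(\beta)$ if and only if $\alpha_m>\beta_m$, where $m$ is the first index with $\alpha_m\ne\beta_m$. Such an $h$ is called a $C^{k+\epsilon}$ embedding if for every $i$ the map $h(\alpha)\mapsto h(i\alpha)$ on $h(\Sigma_d)$ has a $C^{k+\epsilon}$ extension to $\mathbb R$ which is a contraction (Lipschitz with constant less than $1$) and whose derivative does not vanish on $h(\Sigma_d)$. Let $h_1,h_2:\Sigma_d\to\mathbb R$ be two $C^{k+\epsilon}$ embeddings such that $h_2\circ h_1^{-1}:h_1(\Sigma_d)\to h_2(\Sigma_d)$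 extends to a $C^1$ diffeomorphism of $\mathbb R$. Then $h_2\circ h_1^{-1}$ extends to a $C^{k+\epsilon}$ diffeomorphism of $\mathbb R$, that is, to a bijection $\psi:\mathbb R\to\mathbb R$ such that $\psi$ and $\psi^{-1}$ are both $C^{k+\epsilon}$. -/

import Mathlib

open scoped NNReal

/-- The infinite word `iα` obtained by putting the symbol `i` in front of `α`; the map
`prepend i` is the `i`-th right inverse of the shift on `ℕ → Fin d`. -/
def prepend {d : ℕ} (i : Fin d) (α : ℕ → Fin d) : ℕ → Fin d
  | 0 => i
  | n + 1 => α n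

/-- `h` is a topological embedding of the full shift space on `d` symbols into the line,
compatible with the lexicographic order: `h α > h β` iff `α m > β m`, where `m` is the first
place at which `α` and `β` differ. -/
def IsOrderedEmbedding {d : ℕ} (h : (ℕ → Fin d) → ℝ) : Prop :=
  Topology.IsEmbedding h ∧
    ∀ (α β : ℕ → Fin d) (m : ℕ), (∀ i < m, α i = β i) → α m ≠ β m →
      (h α > h β ↔ α m > β m)

/-- `g : ℝ → ℝ` is of class `C^{k+ε}`: it is `C^k` and its `k`-th derivative is Hölder with
exponent `ε` (Lipschitz, if `ε = 1`). -/
def IsCkHolder (k : ℕ) (ε : ℝ≥0) (g : ℝ → ℝ) : Prop :=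
  ContDiff ℝ k g ∧ ∃ C : ℝ≥0, HolderWith C ε (iteratedDeriv k g)

/-- `h` is a `C^{k+ε}` embedding: each right inverse `h α ↦ h (iα)` of the shift map induced on
the image of `h` has a `C^{k+ε}` extension `G` to the line which is a contraction. The derivative
of `G` does not vanish on the image of `h`, that is, `G` is a local diffeomorphism there. -/
def IsCkHolderEmbedding {d : ℕ} (k : ℕ) (ε : ℝ≥0) (h : (ℕ → Fin d) → ℝ) : Prop :=
  IsOrderedEmbedding h ∧
    ∀ i : Fin d, ∃ G : ℝ → ℝ,
      (∀ α, G (h α) = h (prepend i α)) ∧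
      IsCkHolder k ε G ∧
      (∃ K : ℝ≥0, ContractingWith K G) ∧
      ∀ x ∈ Set.range h, deriv G x ≠ 0

/-! A single branch of the inverse shift suffices. Fix a symbol `i`, let `F` and `G` be the
`i`-branches for `h₁` and `h₂`, and let `p` be the point of the constant word `i`, a fixed point of
`F`. On the image of `h₁` the given diffeomorphism `φ` conjugates `F` to `G`.

A `C^{k+ε}` contraction is linearized near its fixed point by a `C^{k+ε}` coordinate
(`exists_linearization`): solve `W = log (F' / F' p) + W ∘ F` by the series of the logarithm along
orbits, and integrate `exp W`. Let `L` and `M` be these coordinates for `F` and `G`. Since `φ` has a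
positive derivative at `p`, `M ∘ φ / L` has a positive limit there. Following an orbit into `p`
shows that the two multipliers agree and that this ratio is constant, so `M ∘ φ = c L` on the part
of the image near `p` (`exists_conjugacy_factor`). This is where differentiability of the conjugacy
is promoted to smoothness.

Some iterate `F^[n]` carries the whole compact image into that neighbourhood, so `M ∘ G^[n] ∘ φ = c
(L ∘ F^[n])` on the image, with both outer functions of class `C^{k+ε}`, increasing and with
positive derivative on the respective images. Off these sets the branches may fail to be injective,
so `exists_increasing_extension` is used twice: to replace `M ∘ G^[n]` by an invertible function,
and to turn the resulting formula for `φ` into a diffeomorphism of the line. The latter has constant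
derivative outside a compact set, which makes local Hölder bounds global. -/

/-! ### Locally uniform Hölder classes and their calculus. -/

/-- A family of functions which on each compact set is bounded and Hölder continuous of exponent
`e`, uniformly in the index. -/
def LocUnifHolder (e : ℝ) {ι : Type*} (f : ι → ℝ → ℝ) : Prop :=
  ∀ K : Set ℝ, IsCompact K → ∃ C : ℝ, 0 ≤ C ∧ ∀ i, ∀ x ∈ K,
    |f i x| ≤ C ∧ ∀ y ∈ K, |f i x - f i y| ≤ C * |x - y| ^ e

/-- A family of functions which is locally bounded in `C^{j+e}`, uniformly in the index. -/
def LocUnifCk (e : ℝ) {ι : Type*} : ℕ → (ι → ℝ → ℝ) → Prop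
  | 0, f => LocUnifHolder e f
  | j + 1, f => LocUnifHolder e f ∧ (∀ i, Differentiable ℝ (f i)) ∧
      LocUnifCk e j (fun i => deriv (f i))

/-- A single function which is locally of class `C^{j+e}`. -/
def LocCk (e : ℝ) (j : ℕ) (f : ℝ → ℝ) : Prop := LocUnifCk e j (fun _ : Unit => f)

section
variable {e : ℝ} {ι : Type*} {f g : ι → ℝ → ℝ} {j : ℕ}

theorem LocUnifCk.holder (h : LocUnifCk e j f) : LocUnifHolder e f := by
  cases j with
  | zero => exact h
  | succ j => exact h.1

theorem LocUnifCk.of_succ (h : LocUnifCk e (j + 1) f) : LocUnifCk e j f := by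
  induction j generalizing f with
  | zero => exact h.1
  | succ j ih => exact ⟨h.1, h.2.1, ih h.2.2⟩

theorem LocUnifHolder.reindex {κ : Type*} (h : LocUnifHolder e f) (r : κ → ι) :
    LocUnifHolder e (fun k => f (r k)) := by
  intro K hK
  obtain ⟨C, hC, H⟩ := h K hK
  exact ⟨C, hC, fun i => H (r i)⟩

theorem LocUnifCk.reindex {κ : Type*} (h : LocUnifCk e j f) (r : κ → ι) :
    LocUnifCk e j (fun k => f (r k)) := by
  induction j generalizing f with
  | zero => exact LocUnifHolder.reindex h r
  | succ j ih => exact ⟨h.1.reindex r, fun k => h.2.1 (r k), ih h.2.2⟩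

theorem LocUnifHolder.continuous (he : 0 < e) (h : LocUnifHolder e f) (i : ι) :
    Continuous (f i) := by
  rw [continuous_iff_continuousAt]
  intro x
  obtain ⟨C, hC, H⟩ := h (Metric.closedBall x 1) (isCompact_closedBall x 1)
  have hx : x ∈ Metric.closedBall x 1 := by simp
  rw [ContinuousAt, tendsto_iff_dist_tendsto_zero]
  have h0 : Filter.Tendsto (fun y => C * |y - x| ^ e) (nhds x) (nhds 0) := by
    have : Continuous (fun y : ℝ => C * |y - x| ^ e) :=
      continuous_const.mul ((continuous_id.sub continuous_const).abs.rpow_const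
        (fun _ => Or.inr he.le))
    have h1 := this.tendsto x
    simpa [Real.zero_rpow he.ne'] using h1
  refine squeeze_zero' (Filter.Eventually.of_forall fun _ => dist_nonneg) ?_ h0
  filter_upwards [Metric.closedBall_mem_nhds x one_pos] with y hy
  rw [Real.dist_eq]
  exact (H i y hy).2 x hx

theorem exists_closedBall_superset (K : Set ℝ) (hK : IsCompact K) (p : ℝ) :
    ∃ R, 0 < R ∧ K ⊆ Metric.closedBall p R := by
  obtain ⟨R, hR⟩ := hK.isBounded.subset_closedBall p
  exact ⟨max R 1, by positivity, hR.trans (Metric.closedBall_subset_closedBall (le_max_left _ _))⟩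

theorem lipschitz_on_ball {F : ℝ → ℝ} (hd : Differentiable ℝ F) {p R C : ℝ}
    (hC : ∀ x ∈ Metric.closedBall p R, |deriv F x| ≤ C) {x y : ℝ}
    (hx : x ∈ Metric.closedBall p R) (hy : y ∈ Metric.closedBall p R) :
    |F x - F y| ≤ C * |x - y| := by
  have := (convex_closedBall p R).norm_image_sub_le_of_norm_deriv_le (f := F) (C := C)
    (fun z _ => hd z) (fun z hz => by simpa using hC z hz) hy hx
  simpa using this

theorem LocUnifHolder.of_one (he : 0 < e) (he1 : e ≤ 1) (hf : LocUnifHolder 1 f) :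
    LocUnifHolder e f := by
  intro K hK
  obtain ⟨R, hR, hKR⟩ := exists_closedBall_superset K hK 0
  obtain ⟨C, hC, H⟩ := hf _ hK
  have hA : 0 ≤ C * (2 * R) ^ (1 - e) := by positivity
  refine ⟨C + C * (2 * R) ^ (1 - e), by positivity, fun i x hx => ⟨?_, fun y hy => ?_⟩⟩
  · linarith [(H i x hx).1]
  · have h1 := (H i x hx).2 y hy
    rw [Real.rpow_one] at h1
    have h2 : |x - y| ≤ 2 * R := by
      have a1 : |x| ≤ R := by simpa [Real.dist_eq] using hKR hx
      have a2 : |y| ≤ R := by simpa [Real.dist_eq] using hKR hy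
      linarith [abs_sub x y]
    have h3 : |x - y| = |x - y| ^ (1 - e) * |x - y| ^ e := by
      rcases eq_or_lt_of_le (abs_nonneg (x - y)) with h | h
      · rw [← h, Real.zero_rpow he.ne', mul_zero]
      · rw [← Real.rpow_add h]; simp
    have h4 : |x - y| ^ (1 - e) ≤ (2 * R) ^ (1 - e) :=
      Real.rpow_le_rpow (abs_nonneg _) h2 (by linarith)
    have h5 : 0 ≤ |x - y| ^ e := by positivity
    calc |f i x - f i y| ≤ C * |x - y| := h1
      _ = C * |x - y| ^ (1 - e) * |x - y| ^ e := by rw [mul_assoc, ← h3]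
      _ ≤ C * (2 * R) ^ (1 - e) * |x - y| ^ e := by gcongr
      _ ≤ _ := by gcongr; linarith

/-- A family with a locally uniformly bounded derivative is locally uniformly Hölder. -/
theorem LocUnifHolder.of_deriv_bound (he : 0 < e) (he1 : e ≤ 1)
    (hd : ∀ i, Differentiable ℝ (f i))
    (hb : ∀ K : Set ℝ, IsCompact K → ∃ C, ∀ i, ∀ x ∈ K, |deriv (f i) x| ≤ C)
    (p : ℝ) (hp : ∃ C, ∀ i, |f i p| ≤ C) : LocUnifHolder e f := by
  refine .of_one he he1 fun K hK => ?_
  obtain ⟨R, hR, hKR⟩ := exists_closedBall_superset K hK p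
  obtain ⟨C, H⟩ := hb _ (isCompact_closedBall p R)
  obtain ⟨D, hD⟩ := hp
  have hpR : p ∈ Metric.closedBall p R := by simp [hR.le]
  have hl : ∀ i, ∀ x ∈ Metric.closedBall p R, ∀ y ∈ Metric.closedBall p R,
      |f i x - f i y| ≤ |C| * |x - y| := fun i x hx y hy =>
    lipschitz_on_ball (hd i) (fun z hz => (H i z hz).trans (le_abs_self C)) hx hy
  refine ⟨|D| + |C| * R + |C|, by positivity, fun i x hx => ⟨?_, fun y hy => ?_⟩⟩
  · have h1 := hl i x (hKR hx) p hpR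
    have h2 : |x - p| ≤ R := by simpa [Real.dist_eq] using hKR hx
    have h3 : |C| * |x - p| ≤ |C| * R := mul_le_mul_of_nonneg_left h2 (abs_nonneg _)
    have h4 : |f i x| ≤ |f i x - f i p| + |f i p| := by
      simpa using abs_add_le (f i x - f i p) (f i p)
    linarith [hD i, le_abs_self D, abs_nonneg C]
  · have h1 := hl i x (hKR hx) y (hKR hy)
    rw [Real.rpow_one]
    refine h1.trans ?_
    gcongr
    have : 0 ≤ |D| + |C| * R := by positivity
    linarith

theorem LocUnifHolder.of_deriv (he : 0 < e) (he1 : e ≤ 1) (hd : ∀ i, Differentiable ℝ (f i))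
    (hf' : LocUnifHolder e (fun i => deriv (f i)))
    (p : ℝ) (hp : ∃ C, ∀ i, |f i p| ≤ C) : LocUnifHolder e f :=
  .of_deriv_bound he he1 hd (fun K hK => (hf' K hK).imp fun _ h i x hx => (h.2 i x hx).1) p hp

theorem LocUnifCk.of_deriv (he : 0 < e) (he1 : e ≤ 1) (hd : ∀ i, Differentiable ℝ (f i))
    (hf' : LocUnifCk e j (fun i => deriv (f i)))
    (p : ℝ) (hp : ∃ C, ∀ i, |f i p| ≤ C) : LocUnifCk e (j + 1) f :=
  ⟨.of_deriv he he1 hd hf'.holder p hp, hd, hf'⟩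

theorem LocUnifHolder.add (hf : LocUnifHolder e f) (hg : LocUnifHolder e g) :
    LocUnifHolder e (fun i x => f i x + g i x) := by
  intro K hK
  obtain ⟨C, hC, H⟩ := hf K hK
  obtain ⟨D, hD, G⟩ := hg K hK
  refine ⟨C + D, by positivity, fun i x hx => ⟨?_, fun y hy => ?_⟩⟩
  · exact (abs_add_le _ _).trans (add_le_add (H i x hx).1 (G i x hx).1)
  · have h1 := (H i x hx).2 y hy
    have h2 := (G i x hx).2 y hy
    have h3 := abs_add_le (f i x - f i y) (g i x - g i y)
    rw [add_sub_add_comm, add_mul]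
    linarith

theorem LocUnifHolder.mul (hf : LocUnifHolder e f) (hg : LocUnifHolder e g) :
    LocUnifHolder e (fun i x => f i x * g i x) := by
  intro K hK
  obtain ⟨C, hC, H⟩ := hf K hK
  obtain ⟨D, hD, G⟩ := hg K hK
  refine ⟨2 * (C * D), by positivity, fun i x hx => ⟨?_, fun y hy => ?_⟩⟩
  · rw [abs_mul]
    have := mul_le_mul (H i x hx).1 (G i x hx).1 (abs_nonneg _) hC
    have : 0 ≤ C * D := by positivity
    linarith
  · have h1 := (H i x hx).2 y hy
    have h2 := (G i x hx).2 y hy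
    have e1 : f i x * g i x - f i y * g i y
        = (f i x - f i y) * g i x + f i y * (g i x - g i y) := by ring
    have h0 : 0 ≤ |x - y| ^ e := by positivity
    calc |f i x * g i x - f i y * g i y|
        ≤ |f i x - f i y| * |g i x| + |f i y| * |g i x - g i y| := by
          rw [e1, ← abs_mul, ← abs_mul]; exact abs_add_le _ _
      _ ≤ (C * |x - y| ^ e) * D + C * (D * |x - y| ^ e) :=
          add_le_add (mul_le_mul h1 (G i x hx).1 (abs_nonneg _) (by positivity))
            (mul_le_mul (H i y hy).1 h2 (abs_nonneg _) hC)
      _ = _ := by ring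

theorem LocUnifCk.add (hf : LocUnifCk e j f) (hg : LocUnifCk e j g) :
    LocUnifCk e j (fun i x => f i x + g i x) := by
  induction j generalizing f g with
  | zero => exact LocUnifHolder.add hf hg
  | succ j ih =>
    refine ⟨hf.1.add hg.1, fun i => (hf.2.1 i).add (hg.2.1 i), ?_⟩
    have : (fun i => deriv (fun x => f i x + g i x)) =
        fun i x => deriv (f i) x + deriv (g i) x := by
      funext i x; exact deriv_fun_add (hf.2.1 i x) (hg.2.1 i x)
    rw [this]
    exact ih hf.2.2 hg.2.2

theorem LocUnifCk.mul (hf : LocUnifCk e j f) (hg : LocUnifCk e j g) :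
    LocUnifCk e j (fun i x => f i x * g i x) := by
  induction j generalizing f g with
  | zero => exact LocUnifHolder.mul hf hg
  | succ j ih =>
    refine ⟨hf.1.mul hg.1, fun i => (hf.2.1 i).mul (hg.2.1 i), ?_⟩
    have : (fun i => deriv (fun x => f i x * g i x)) =
        fun i x => deriv (f i) x * g i x + f i x * deriv (g i) x := by
      funext i x; exact deriv_fun_mul (hf.2.1 i x) (hg.2.1 i x)
    rw [this]
    exact (ih hf.2.2 hg.of_succ).add (ih hf.of_succ hg.2.2)

theorem LocUnifHolder.comp {F : ℝ → ℝ} (he : 0 < e) (hf : LocUnifHolder e f)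
    (hF : ContDiff ℝ 1 F) : LocUnifHolder e (fun i x => f i (F x)) := by
  intro K hK
  obtain ⟨R, hR, hKR⟩ := exists_closedBall_superset K hK 0
  obtain ⟨C, hC, H⟩ := hf _ ((isCompact_closedBall 0 R).image hF.continuous)
  obtain ⟨D, hD⟩ := (isCompact_closedBall (0 : ℝ) R).exists_bound_of_continuousOn
    (hF.continuous_deriv le_rfl).continuousOn
  have hD0 : 0 ≤ D := (norm_nonneg _).trans (hD 0 (by simp [hR.le]))
  have hde : 0 ≤ C * D ^ e := by positivity
  refine ⟨C + C * D ^ e, by positivity, fun i x hx => ⟨?_, fun y hy => ?_⟩⟩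
  · have := (H i (F x) ⟨x, hKR hx, rfl⟩).1
    linarith
  · have h1 := (H i (F x) ⟨x, hKR hx, rfl⟩).2 (F y) ⟨y, hKR hy, rfl⟩
    have h2 := lipschitz_on_ball (hF.differentiable one_ne_zero) hD (hKR hx) (hKR hy)
    have h3 : |F x - F y| ^ e ≤ D ^ e * |x - y| ^ e := by
      rw [← Real.mul_rpow hD0 (abs_nonneg _)]
      exact Real.rpow_le_rpow (abs_nonneg _) h2 he.le
    have h0 : 0 ≤ |x - y| ^ e := by positivity
    calc _ ≤ C * |F x - F y| ^ e := h1
      _ ≤ C * (D ^ e * |x - y| ^ e) := by gcongr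
      _ ≤ _ := by rw [← mul_assoc]; gcongr; linarith

theorem LocUnifCk.contDiff (he : 0 < e) (hf : LocUnifCk e j f) (i : ι) : ContDiff ℝ j (f i) := by
  induction j generalizing f with
  | zero => simpa using LocUnifHolder.continuous he hf i
  | succ j ih =>
    push_cast
    rw [contDiff_succ_iff_deriv]
    refine ⟨hf.2.1 i, ?_, ih hf.2.2⟩
    intro h
    simp at h

/-- The inner function is required to be `C¹` separately because at `j = 0` its class is only
Hölder, and composing two Hölder functions would lose exponent. -/
theorem LocUnifCk.comp {F : ℝ → ℝ} (he : 0 < e) (hf : LocUnifCk e j f)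
    (hF1 : ContDiff ℝ 1 F) (hF : LocCk e j F) : LocUnifCk e j (fun i x => f i (F x)) := by
  induction j generalizing f with
  | zero => exact LocUnifHolder.comp he hf hF1
  | succ j ih =>
    have hFd := hF1.differentiable one_ne_zero
    refine ⟨hf.1.comp he hF1, fun i => (hf.2.1 i).comp hFd, ?_⟩
    have : (fun i => deriv (fun x => f i (F x))) =
        fun i x => deriv (f i) (F x) * deriv F x := by
      funext i x; exact deriv_comp x (hf.2.1 i (F x)) (hFd x)
    rw [this]
    exact (ih hf.2.2 hF.of_succ).mul (LocUnifCk.reindex hF.2.2 (fun _ => ()))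

theorem LocUnifHolder.of_contDiff {F : ℝ → ℝ} (he : 0 < e) (he1 : e ≤ 1)
    (hF : ContDiff ℝ 1 F) : LocUnifHolder e (fun _ : Unit => F) := by
  refine .of_deriv_bound he he1 (fun _ => hF.differentiable one_ne_zero) (fun K hK => ?_) 0
    ⟨|F 0|, fun _ => le_rfl⟩
  obtain ⟨D, hD⟩ := hK.exists_bound_of_continuousOn (hF.continuous_deriv le_rfl).continuousOn
  exact ⟨D, fun _ x hx => hD x hx⟩

theorem LocCk.of_contDiff (he : 0 < e) (he1 : e ≤ 1) {F : ℝ → ℝ}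
    (hF : ContDiff ℝ (j + 1 : ℕ) F) : LocCk e j F := by
  induction j generalizing F with
  | zero => exact LocUnifHolder.of_contDiff he he1 (by simpa using hF)
  | succ j ih =>
    have h1 : ContDiff ℝ 1 F := hF.of_le (by norm_cast; omega)
    have h2 : ContDiff ℝ ((j + 1 : ℕ) + 1) F := by exact_mod_cast hF
    exact ⟨.of_contDiff he he1 h1, fun _ => h1.differentiable one_ne_zero,
      ih (contDiff_succ_iff_deriv.1 h2).2.2⟩

end

/-! ### Single functions: inverses, and passage between local and global classes. -/

section
variable {e : ℝ} {f g : ℝ → ℝ} {j : ℕ}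

theorem LocCk.of_smooth (he : 0 < e) (he1 : e ≤ 1) (hf : ContDiff ℝ (⊤ : ℕ∞) f) : LocCk e j f :=
  .of_contDiff he he1 (hf.of_le (by exact_mod_cast le_top))

theorem LocCk.add (hf : LocCk e j f) (hg : LocCk e j g) : LocCk e j (fun x => f x + g x) :=
  LocUnifCk.add hf hg

theorem LocCk.mul (hf : LocCk e j f) (hg : LocCk e j g) : LocCk e j (fun x => f x * g x) :=
  LocUnifCk.mul hf hg

theorem LocCk.contDiff (he : 0 < e) (hf : LocCk e j f) : ContDiff ℝ j f :=
  LocUnifCk.contDiff he hf ()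

theorem LocCk.contDiff_one (he : 0 < e) (hf : LocCk e (j + 1) f) : ContDiff ℝ 1 f :=
  (hf.contDiff he).of_le (by norm_cast; omega)

theorem LocCk.comp (he : 0 < e) (hf : LocCk e j f) (hg1 : ContDiff ℝ 1 g) (hg : LocCk e j g) :
    LocCk e j (fun x => f (g x)) :=
  LocUnifCk.comp he hf hg1 hg

theorem LocCk.of_deriv (he : 0 < e) (he1 : e ≤ 1) (hd : Differentiable ℝ f)
    (hf : LocCk e j (deriv f)) : LocCk e (j + 1) f :=
  LocUnifCk.of_deriv he he1 (fun _ => hd) hf 0 ⟨|f 0|, fun _ => le_rfl⟩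

/-- At `j = 0` the inner function need not be `C¹`; the exponent survives because the outer function
is locally Lipschitz. -/
theorem LocCk.smooth_comp (he : 0 < e) (he1 : e ≤ 1) (hf : ContDiff ℝ (⊤ : ℕ∞) f)
    (hg : LocCk e j g) : LocCk e j (fun x => f (g x)) := by
  rcases j with _ | j
  · have hc : Continuous g := hg.continuous he ()
    intro Q hQ
    obtain ⟨C, hC, H⟩ := hg Q hQ
    obtain ⟨D, hD, G⟩ := LocUnifHolder.of_contDiff one_pos le_rfl
      (hf.of_le (by exact_mod_cast le_top)) _ (hQ.image hc)
    refine ⟨D + D * C, by positivity, fun _ x hx => ⟨?_, fun y hy => ?_⟩⟩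
    · exact (G () _ ⟨x, hx, rfl⟩).1.trans (by linarith [mul_nonneg hD hC])
    · have h1 := (G () _ ⟨x, hx, rfl⟩).2 _ ⟨y, hy, rfl⟩
      rw [Real.rpow_one] at h1
      have h2 := (H () x hx).2 y hy
      have h3 : 0 ≤ |x - y| ^ e := by positivity
      calc _ ≤ D * |g x - g y| := h1
        _ ≤ D * (C * |x - y| ^ e) := by gcongr
        _ ≤ _ := by rw [← mul_assoc]; gcongr; linarith
  · exact LocCk.comp he (.of_smooth he he1 hf) (hg.contDiff_one he) hg

theorem LocCk.const (he : 0 < e) (he1 : e ≤ 1) (c : ℝ) : LocCk e j (fun _ => c) :=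
  .of_smooth he he1 contDiff_const

theorem LocCk.iterate (he : 0 < e) (he1 : e ≤ 1) (hf : LocCk e (j + 1) f) (n : ℕ) :
    LocCk e (j + 1) f^[n] := by
  induction n with
  | zero => exact .of_smooth he he1 contDiff_id
  | succ n ih => rw [Function.iterate_succ]; exact LocCk.comp (f := f^[n]) he ih (hf.contDiff_one he) hf

theorem LocCk.inv (he : 0 < e) (he1 : e ≤ 1) (hf : LocCk e j f) (hf0 : ∀ x, f x ≠ 0) :
    LocCk e j (fun x => (f x)⁻¹) := by
  induction j with
  | zero =>
    intro K hK
    obtain ⟨C, hC, H⟩ := hf K hK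
    have hc := LocUnifHolder.continuous he hf ()
    obtain ⟨D, hD⟩ := hK.exists_bound_of_continuousOn (hc.inv₀ hf0).continuousOn
    simp only [Pi.inv_apply, Real.norm_eq_abs] at hD
    refine ⟨|D| + D ^ 2 * C, by positivity, fun i x hx => ⟨?_, fun y hy => ?_⟩⟩
    · have h1 := hD x hx
      have : 0 ≤ D ^ 2 * C := by positivity
      have := le_abs_self D
      exact h1.trans (by linarith)
    · have hx1 := hD x hx
      have hy1 := hD y hy
      have hD0 : 0 ≤ D := (abs_nonneg _).trans hx1
      have h1 := (H () y hy).2 x hx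
      have e1 : (f x)⁻¹ - (f y)⁻¹ = (f x)⁻¹ * (f y)⁻¹ * (f y - f x) := by
        have := hf0 x; have := hf0 y; field_simp
      rw [e1, abs_mul, abs_mul, abs_sub_comm x y]
      have h0 : 0 ≤ |y - x| ^ e := by positivity
      calc _ ≤ D * D * (C * |y - x| ^ e) := by gcongr
        _ ≤ _ := by
          have : 0 ≤ |D| * |y - x| ^ e := by positivity
          nlinarith
  | succ j ih =>
    refine .of_deriv he he1 (fun x => (hf.2.1 () x).inv (hf0 x)) ?_
    have : deriv (fun x => (f x)⁻¹) = fun x => (-1 * deriv f x) * ((f x)⁻¹ * (f x)⁻¹) := by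
      funext x
      rw [deriv_fun_inv'' (hf.2.1 () x) (hf0 x)]
      field_simp
    rw [this]
    have h := ih hf.of_succ
    exact ((LocCk.const he he1 (-1)).mul hf.2.2).mul (h.mul h)

/-- The inverse of a `C^{j+1+e}` diffeomorphism is of class `C^{j+1+e}`. -/
theorem LocCk.symm (he : 0 < e) (he1 : e ≤ 1) (φ : ℝ ≃ₜ ℝ) (hf : LocCk e (j + 1) φ)
    (hf0 : ∀ x, deriv φ x ≠ 0) :
    LocCk e (j + 1) φ.symm ∧ ∀ x, deriv φ.symm x = (deriv φ (φ.symm x))⁻¹ := by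
  have hder : ∀ x, HasDerivAt φ.symm (deriv φ (φ.symm x))⁻¹ x := fun x =>
    φ.toOpenPartialHomeomorph.hasDerivAt_symm (by simp) (hf0 _)
      (hf.2.1 () _).hasDerivAt
  have hd : Differentiable ℝ φ.symm := fun x => (hder x).differentiableAt
  have hd' : deriv φ.symm = fun x => (deriv φ (φ.symm x))⁻¹ := funext fun x => (hder x).deriv
  have h1 : ContDiff ℝ 1 φ.symm := by
    rw [contDiff_one_iff_deriv]
    refine ⟨hd, ?_⟩
    rw [hd']
    exact (((hf.contDiff_one he).continuous_deriv le_rfl).comp φ.symm.continuous).inv₀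
      (fun x => hf0 _)
  refine ⟨?_, fun x => (hder x).deriv⟩
  -- Bootstrapping: the derivative of the inverse is `1 / φ'` composed with the inverse, so each
  -- degree of regularity of the inverse yields the next one. The start needs the inverse to be
  -- `C¹`.
  induction j with
  | zero =>
    refine .of_deriv he he1 hd ?_
    rw [hd']
    exact LocCk.inv he he1 (LocCk.comp he hf.2.2 h1 (LocUnifHolder.of_contDiff he he1 h1))
      (fun x => hf0 _)
  | succ j ih =>
    refine .of_deriv he he1 hd ?_
    rw [hd']
    exact LocCk.inv he he1 (LocCk.comp he hf.2.2 h1 (ih hf.of_succ)) (fun x => hf0 _)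

theorem IsCkHolder.locCk {ε : ℝ≥0} (hε : 0 < ε) (hε1 : ε ≤ 1) {k : ℕ} (h : IsCkHolder k ε f) :
    LocCk ε k f := by
  have he : (0 : ℝ) < ε := hε
  have he1 : (ε : ℝ) ≤ 1 := hε1
  obtain ⟨hc, C, hC⟩ := h
  induction k generalizing f with
  | zero =>
    rw [iteratedDeriv_zero] at hC
    intro K hK
    obtain ⟨D, hD⟩ := hK.exists_bound_of_continuousOn hc.continuous.continuousOn
    refine ⟨|D| + C, by positivity, fun i x hx => ⟨?_, fun y hy => ?_⟩⟩
    · have := hD x hx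
      rw [Real.norm_eq_abs] at this
      have := le_abs_self D
      have : (0 : ℝ) ≤ C := C.2
      linarith
    · have := hC.dist_le x y
      rw [Real.dist_eq, Real.dist_eq] at this
      refine this.trans ?_
      gcongr
      linarith [abs_nonneg D]
  | succ k ih =>
    have hc' : ContDiff ℝ ((k : ℕ) + 1) f := by exact_mod_cast hc
    rw [contDiff_succ_iff_deriv] at hc'
    rw [iteratedDeriv_succ'] at hC
    exact .of_deriv he he1 hc'.1 (ih hc'.2.2 hC)

theorem LocCk.holder_iteratedDeriv {k : ℕ} (h : LocCk e k f) :
    LocCk e 0 (iteratedDeriv k f) := by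
  induction k generalizing f with
  | zero => simpa using h
  | succ k ih => rw [iteratedDeriv_succ']; exact ih h.2.2

/-- A function which is locally of class `C^{k+ε}` and affine near `-∞` and near `∞` is globally
of class `C^{k+ε}`. -/
theorem LocCk.isCkHolder {ε : ℝ≥0} (hε : 0 < ε) {k : ℕ} (h : LocCk ε (k + 1) f)
    {a b c : ℝ} (hab : a ≤ b) (ha : ∀ x < a, deriv f x = c) (hb : ∀ x > b, deriv f x = c) :
    IsCkHolder (k + 1) ε f := by
  have he : (0 : ℝ) < ε := hε
  refine ⟨h.contDiff he, ?_⟩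
  set g := iteratedDeriv (k + 1) f with hg
  have hgc : Continuous g := LocUnifHolder.continuous he h.holder_iteratedDeriv ()
  have key : ∀ x, x < a ∨ b < x → g x = iteratedDeriv k (fun _ : ℝ => c) 0 := by
    intro x hx
    have h1 : deriv f =ᶠ[nhds x] fun _ => c := by
      rcases hx with hx | hx
      · filter_upwards [Iio_mem_nhds hx] with y hy using ha y hy
      · filter_upwards [Ioi_mem_nhds hx] with y hy using hb y hy
    rw [hg, iteratedDeriv_succ', h1.iteratedDeriv_eq]
    cases k <;> simp [iteratedDeriv_const]
  have hlim : ∀ x, x ≤ a ∨ b ≤ x → g x = iteratedDeriv k (fun _ : ℝ => c) 0 := by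
    rintro x (hx | hx)
    · have : Set.EqOn g (fun _ => iteratedDeriv k (fun _ : ℝ => c) 0) (closure (Set.Iio a)) :=
        Set.EqOn.closure (fun y hy => key y (Or.inl hy)) hgc continuous_const
      exact this (by simpa using hx)
    · have : Set.EqOn g (fun _ => iteratedDeriv k (fun _ : ℝ => c) 0) (closure (Set.Ioi b)) :=
        Set.EqOn.closure (fun y hy => key y (Or.inr hy)) hgc continuous_const
      exact this (by simpa using hx)
  -- The top derivative factors through the projection of the line onto `[a, b]`, which is
  -- `1`-Lipschitz, so a Hölder constant on this interval serves everywhere.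
  have hclamp : ∀ x, g x = g (max a (min b x)) := by
    intro x
    rcases le_total x a with hx | hx
    · rw [min_eq_right (hx.trans hab), max_eq_left hx, hlim x (Or.inl hx), hlim a (Or.inl le_rfl)]
    · rcases le_total x b with hx' | hx'
      · rw [min_eq_right hx', max_eq_right hx]
      · rw [min_eq_left hx', max_eq_right hab, hlim x (Or.inr hx'), hlim b (Or.inr le_rfl)]
  obtain ⟨C, hC, H⟩ := h.holder_iteratedDeriv (Set.Icc a b) isCompact_Icc
  have hlip : ∀ x y : ℝ, |max a (min b x) - max a (min b y)| ≤ |x - y| := fun x y =>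
    (abs_max_sub_max_le_max _ _ _ _).trans (max_le (by simp) <|
      (abs_min_sub_min_le_max _ _ _ _).trans (max_le (by simp) le_rfl))
  have hmem : ∀ x : ℝ, max a (min b x) ∈ Set.Icc a b := fun x =>
    ⟨le_max_left _ _, max_le hab (min_le_left _ _)⟩
  have hreal : ∀ x y, |g x - g y| ≤ C * |x - y| ^ (ε : ℝ) := fun x y => by
    rw [hclamp x, hclamp y]
    refine ((H () _ (hmem x)).2 _ (hmem y)).trans ?_
    exact mul_le_mul_of_nonneg_left (Real.rpow_le_rpow (abs_nonneg _) (hlip x y) he.le) hC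
  lift C to ℝ≥0 using hC
  refine ⟨C, fun x y => ?_⟩
  rw [edist_nndist, edist_nndist, ← ENNReal.coe_rpow_of_nonneg _ he.le, ← ENNReal.coe_mul,
    ENNReal.coe_le_coe, ← NNReal.coe_le_coe]
  simpa [Real.dist_eq] using hreal x y

end

/-! ### Affine recursions and the cohomological equation. -/

theorem fixed_ball {F : ℝ → ℝ} (hd : Differentiable ℝ F) {p : ℝ} (hp : F p = p)
    (hF' : ∀ x, |deriv F x| ≤ 1) {R x : ℝ} (hx : x ∈ Metric.closedBall p R) :
    F x ∈ Metric.closedBall p R := by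
  have hpR : p ∈ Metric.closedBall p R :=
    Metric.mem_closedBall_self (dist_nonneg.trans (Metric.mem_closedBall.1 hx))
  have := lipschitz_on_ball hd (fun z _ => hF' z) hx hpR
  rw [hp, one_mul] at this
  rw [Metric.mem_closedBall, Real.dist_eq] at hx ⊢
  exact this.trans hx

/-- The solutions of a recursion `S (n+1) = b * (S n ∘ F) + E n` with `|b| ≤ q < 1` are locally
uniformly Hölder, if the inhomogeneous terms are. -/
theorem LocUnifHolder.of_recursion {e : ℝ} (he : 0 < e) {F b : ℝ → ℝ} {S E : ℕ → ℝ → ℝ}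
    {p q : ℝ} (hd : Differentiable ℝ F) (hp : F p = p) (hF' : ∀ x, |deriv F x| ≤ 1)
    (hb : LocUnifHolder e (fun _ : Unit => b))
    (hbq : ∀ x, |b x| ≤ q) (hq : q < 1) (hE : LocUnifHolder e E)
    (h0 : LocUnifHolder e (fun _ : Unit => S 0))
    (hS : ∀ n x, S (n + 1) x = b x * S n (F x) + E n x) : LocUnifHolder e S := by
  intro K hK
  obtain ⟨R, hR, hKR⟩ := exists_closedBall_superset K hK p
  have hB := isCompact_closedBall p R
  obtain ⟨B, hB0, HB⟩ := hb _ hB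
  obtain ⟨C, hC0, HC⟩ := hE _ hB
  obtain ⟨A, hA0, HA⟩ := h0 _ hB
  have hq0 : 0 ≤ q := (abs_nonneg _).trans (hbq 0)
  have hq1 : 0 < 1 - q := by linarith
  -- Chosen so that `A ≤ M` and `q * M + C ≤ M`: the bound starts and propagates. `H` below plays
  -- the same role for the Hölder seminorm, with `B * M + C` as inhomogeneous bound.
  set M := A + C / (1 - q) with hM
  have hCq : 0 ≤ C / (1 - q) := by positivity
  have hM0 : 0 ≤ M := by positivity
  have hsup : ∀ n, ∀ x ∈ Metric.closedBall p R, |S n x| ≤ M := by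
    intro n
    induction n with
    | zero => intro x hx; exact (HA () x hx).1.trans (by linarith)
    | succ n ih =>
      intro x hx
      rw [hS]
      have h1 := ih _ (fixed_ball hd hp hF' hx)
      have h2 := (HC n x hx).1
      have h3 : |b x * S n (F x)| ≤ q * M := by
        rw [abs_mul]; exact mul_le_mul (hbq x) h1 (abs_nonneg _) hq0
      have h4 : q * M + C ≤ M := by
        have : (1 - q) * M = (1 - q) * A + C := by rw [hM]; field_simp
        have : 0 ≤ (1 - q) * A := by positivity
        linarith
      exact (abs_add_le _ _).trans (by linarith)
  set H := A + (B * M + C) / (1 - q) with hH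
  have hCq' : 0 ≤ (B * M + C) / (1 - q) := by positivity
  have hH0 : 0 ≤ H := by positivity
  have hhol : ∀ n, ∀ x ∈ Metric.closedBall p R, ∀ y ∈ Metric.closedBall p R,
      |S n x - S n y| ≤ H * |x - y| ^ e := by
    intro n
    induction n with
    | zero =>
      intro x hx y hy
      refine ((HA () x hx).2 y hy).trans ?_
      gcongr
      linarith
    | succ n ih =>
      intro x hx y hy
      rw [hS, hS]
      have hFx := fixed_ball hd hp hF' hx
      have hFy := fixed_ball hd hp hF' hy
      set t := |x - y| ^ e
      have ht : 0 ≤ t := by positivity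
      have h1 : |S n (F x) - S n (F y)| ≤ H * t := by
        refine (ih _ hFx _ hFy).trans ?_
        have := lipschitz_on_ball hd (fun z _ => hF' z) hx hy
        rw [one_mul] at this
        exact mul_le_mul_of_nonneg_left (Real.rpow_le_rpow (abs_nonneg _) this he.le) hH0
      have h2 := (HC n x hx).2 y hy
      have h3 := (HB () x hx).2 y hy
      have h4 := hsup n _ hFy
      have e1 : b x * S n (F x) + E n x - (b y * S n (F y) + E n y)
          = b x * (S n (F x) - S n (F y)) + (b x - b y) * S n (F y) + (E n x - E n y) := by ring
      rw [e1]
      have h5 : |b x * (S n (F x) - S n (F y))| ≤ q * (H * t) := by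
        rw [abs_mul]; exact mul_le_mul (hbq x) h1 (abs_nonneg _) hq0
      have h6 : |(b x - b y) * S n (F y)| ≤ (B * t) * M := by
        rw [abs_mul]; exact mul_le_mul h3 h4 (abs_nonneg _) (by positivity)
      have h7 : q * H + B * M + C ≤ H := by
        have : (1 - q) * H = (1 - q) * A + (B * M + C) := by rw [hH]; field_simp
        have : 0 ≤ (1 - q) * A := by positivity
        linarith
      have h8 := mul_le_mul_of_nonneg_right h7 ht
      refine (abs_add_three _ _ _).trans ?_
      linarith
  refine ⟨M + H, by positivity, fun n x hx => ⟨(hsup n x (hKR hx)).trans (by linarith),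
    fun y hy => (hhol n x (hKR hx) y (hKR hy)).trans ?_⟩⟩
  gcongr
  linarith

/-- Differentiating the recursion gives one of the same type for the derivatives, with coefficient
`b * F'`. It is still bounded by `q` since `|F'| ≤ 1`, and its inhomogeneous term involves only `S`
itself, already controlled at the lower order. -/
theorem LocUnifCk.of_recursion {e : ℝ} (he : 0 < e) {j : ℕ} {F b : ℝ → ℝ}
    {S E : ℕ → ℝ → ℝ} {p q : ℝ} (hF1 : ContDiff ℝ 1 F) (hF : LocCk e j F) (hp : F p = p)
    (hF' : ∀ x, |deriv F x| ≤ 1) (hb : LocCk e j b) (hbq : ∀ x, |b x| ≤ q) (hq : q < 1)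
    (hE : LocUnifCk e j E) (h0 : LocCk e j (S 0))
    (hS : ∀ n x, S (n + 1) x = b x * S n (F x) + E n x) : LocUnifCk e j S := by
  have hd := hF1.differentiable one_ne_zero
  induction j generalizing b S E with
  | zero => exact LocUnifHolder.of_recursion he hd hp hF' hb hbq hq hE h0 hS
  | succ j ih =>
    have hSj : LocUnifCk e j S := ih hF.of_succ hb.of_succ hbq hE.of_succ h0.of_succ hS
    have hbd : Differentiable ℝ b := hb.2.1 ()
    have hS' : ∀ n, S (n + 1) = fun x => b x * S n (F x) + E n x := fun n => funext (hS n)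
    have hSd : ∀ n, Differentiable ℝ (S n) := by
      intro n
      induction n with
      | zero => exact h0.2.1 ()
      | succ n ihn => rw [hS' n]; exact (hbd.mul (ihn.comp hd)).add (hE.2.1 n)
    refine ⟨hSj.holder, hSd, ?_⟩
    refine ih (b := fun x => b x * deriv F x)
      (E := fun n x => deriv b x * S n (F x) + deriv (E n) x) hF.of_succ
      (hb.of_succ.mul hF.2.2) (fun x => ?_)
      (((LocUnifCk.reindex hb.2.2 (fun _ => ())).mul (hSj.comp he hF1 hF.of_succ)).add hE.2.2)
      h0.2.2 (fun n x => ?_)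
    · rw [abs_mul]
      exact (mul_le_of_le_one_right (abs_nonneg _) (hF' x)).trans (hbq x)
    · have h1 : HasDerivAt (fun x => S n (F x)) (deriv (S n) (F x) * deriv F x) x :=
        (hSd n (F x)).hasDerivAt.comp x (hd x).hasDerivAt
      have h2 := ((hbd x).hasDerivAt.mul h1).add (hE.2.1 n x).hasDerivAt
      rw [hS' n]
      refine h2.deriv.trans ?_
      ring

section
variable {e σ : ℝ} {S : ℕ → ℝ → ℝ}

theorem LocUnifHolder.summable (hS : LocUnifHolder e S) (hσ : 0 ≤ σ) (hσ1 : σ < 1) (x : ℝ) :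
    Summable fun n => σ ^ n * S n x := by
  obtain ⟨C, hC, H⟩ := hS {x} isCompact_singleton
  refine Summable.of_norm_bounded ((summable_geometric_of_lt_one hσ hσ1).mul_right C) fun n => ?_
  rw [Real.norm_eq_abs, abs_mul, abs_of_nonneg (pow_nonneg hσ n)]
  have := (H n x rfl).1
  gcongr

theorem LocUnifHolder.tsum (hS : LocUnifHolder e S) (hσ : 0 ≤ σ) (hσ1 : σ < 1) :
    LocUnifHolder e (fun (_ : Unit) x => ∑' n, σ ^ n * S n x) := by
  intro K hK
  obtain ⟨C, hC, H⟩ := hS K hK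
  have hg := hasSum_geometric_of_lt_one hσ hσ1
  have h1 : 0 ≤ (1 - σ)⁻¹ := inv_nonneg.2 (by linarith)
  refine ⟨(1 - σ)⁻¹ * C, by positivity, fun _ x hx => ⟨?_, fun y hy => ?_⟩⟩
  · rw [← Real.norm_eq_abs]
    refine tsum_of_norm_bounded (hg.mul_right C) fun n => ?_
    rw [Real.norm_eq_abs, abs_mul, abs_of_nonneg (pow_nonneg hσ n)]
    have := (H n x hx).1
    gcongr
  · rw [← (hS.summable hσ hσ1 x).tsum_sub (hS.summable hσ hσ1 y), mul_assoc,
      ← Real.norm_eq_abs]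
    refine tsum_of_norm_bounded (hg.mul_right (C * |x - y| ^ e)) fun n => ?_
    rw [← mul_sub, Real.norm_eq_abs, abs_mul, abs_of_nonneg (pow_nonneg hσ n)]
    have := (H n x hx).2 y hy
    gcongr

theorem LocUnifCk.tsum {j : ℕ} (hS : LocUnifCk e j S) (hσ : 0 ≤ σ) (hσ1 : σ < 1) :
    LocCk e j (fun x => ∑' n, σ ^ n * S n x) := by
  induction j generalizing S with
  | zero => exact LocUnifHolder.tsum hS hσ hσ1
  | succ j ih =>
    have hder : ∀ x, HasDerivAt (fun x => ∑' n, σ ^ n * S n x)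
        (∑' n, σ ^ n * deriv (S n) x) x := by
      intro x
      obtain ⟨C, hC, H⟩ := hS.2.2.holder _ (isCompact_closedBall x 1)
      refine hasDerivAt_tsum_of_isPreconnected
        ((summable_geometric_of_lt_one hσ hσ1).mul_right C) Metric.isOpen_ball
        (convex_ball x 1).isPreconnected
        (fun n y _ => (hS.2.1 n y).hasDerivAt.const_mul _) (fun n y hy => ?_)
        (Metric.mem_ball_self one_pos) (hS.1.summable hσ hσ1 x) (Metric.mem_ball_self one_pos)
      rw [Real.norm_eq_abs, abs_mul, abs_of_nonneg (pow_nonneg hσ n)]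
      have := (H n y (Metric.ball_subset_closedBall hy)).1
      gcongr
    refine ⟨hS.1.tsum hσ hσ1, fun _ x => (hder x).differentiableAt, ?_⟩
    have : deriv (fun x => ∑' n, σ ^ n * S n x) = fun x => ∑' n, σ ^ n * deriv (S n) x :=
      funext fun x => (hder x).deriv
    simp only [this]
    exact ih hS.2.2

end

/-- For a contraction `F` with fixed point `p` and a function `a` vanishing at `p`, the
cohomological equation `W = a + W ∘ F` has a solution as smooth as the data. -/
theorem exists_cohomological_solution {e : ℝ} (he : 0 < e) (he1 : e ≤ 1) {j : ℕ} {F a : ℝ → ℝ}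
    {p K : ℝ} (hF : LocCk e (j + 1) F) (hp : F p = p) (hK : K < 1) (hF' : ∀ x, |deriv F x| ≤ K)
    (ha : LocCk e j a) (hap : a p = 0) :
    ∃ W, LocCk e j W ∧ W p = 0 ∧ ∀ x, W x = a x + W (F x) := by
  have hK0 : 0 ≤ K := (abs_nonneg _).trans (hF' 0)
  have hF1 := hF.contDiff_one he
  have hd := hF1.differentiable one_ne_zero
  have hKe : K ^ e < 1 := Real.rpow_lt_one hK0 hK he
  have hKKe : K ≤ K ^ e := Real.self_le_rpow_of_le_one hK0 hK.le he1
  -- The solution is the sum of `a ∘ F^[n]`, written as the sum of `σ ^ n * S n`. As `a` vanishes at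
  -- `p`, its Hölder bound makes these terms decay like `(K ^ e) ^ n`, so with `K ^ e < σ < 1` the
  -- `S n` stay bounded and the weights remain summable.
  set σ := (K ^ e + 1) / 2 with hσ
  have hσ1 : σ < 1 := by linarith
  have hσK : K ^ e < σ := by linarith
  have hσ0 : 0 < σ := by linarith
  set S : ℕ → ℝ → ℝ := fun n x => (σ ^ n)⁻¹ * a (F^[n] x) with hSdef
  have hS : ∀ n x, S (n + 1) x = σ⁻¹ * S n (F x) := fun n x => by
    simp only [hSdef, Function.iterate_succ_apply, pow_succ, mul_inv]; ring
  have hit : ∀ n x y, |F^[n] x - F^[n] y| ≤ K ^ n * |x - y| := by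
    intro n
    induction n with
    | zero => intro x y; simp
    | succ n ih =>
      intro x y
      obtain ⟨R, hR⟩ : ∃ R, |x| ≤ R ∧ |y| ≤ R := ⟨max |x| |y|, le_max_left _ _, le_max_right _ _⟩
      have h1 := lipschitz_on_ball (p := 0) (R := R) hd (fun z _ => hF' z) (x := x) (y := y)
        (by simpa using hR.1) (by simpa using hR.2)
      rw [Function.iterate_succ_apply, Function.iterate_succ_apply, pow_succ, mul_assoc]
      exact (ih _ _).trans (by gcongr)
  have hitp : ∀ n, F^[n] p = p := fun n => Function.iterate_fixed hp n
  have hS0 : LocUnifHolder e S := by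
    intro Q hQ
    obtain ⟨R, hR, hQR⟩ := exists_closedBall_superset Q hQ p
    obtain ⟨C, hC, H⟩ := ha.holder _ (isCompact_closedBall p R)
    have hmem : ∀ n, ∀ x ∈ Metric.closedBall p R, F^[n] x ∈ Metric.closedBall p R := by
      intro n
      induction n with
      | zero => intro x hx; exact hx
      | succ n ih =>
        intro x hx
        rw [Function.iterate_succ_apply]
        exact ih _ (fixed_ball hd hp (fun z => (hF' z).trans hK.le) hx)
    have hbd : ∀ n, ∀ x ∈ Metric.closedBall p R, ∀ y ∈ Metric.closedBall p R,
        |S n x - S n y| ≤ C * |x - y| ^ e := by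
      intro n x hx y hy
      have h1 := (H () _ (hmem n x hx)).2 _ (hmem n y hy)
      have h2 : |F^[n] x - F^[n] y| ^ e ≤ (K ^ e) ^ n * |x - y| ^ e := by
        refine (Real.rpow_le_rpow (abs_nonneg _) (hit n x y) he.le).trans (le_of_eq ?_)
        rw [Real.mul_rpow (by positivity) (abs_nonneg _), ← Real.rpow_natCast,
          ← Real.rpow_mul hK0, ← Real.rpow_natCast, ← Real.rpow_mul hK0, mul_comm (n : ℝ)]
      have h3 : (K ^ e) ^ n ≤ σ ^ n := by gcongr
      simp only [hSdef]
      rw [← mul_sub, abs_mul, abs_of_pos (by positivity : 0 < (σ ^ n)⁻¹), inv_mul_le_iff₀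
        (by positivity)]
      calc _ ≤ C * |F^[n] x - F^[n] y| ^ e := h1
        _ ≤ C * (σ ^ n * |x - y| ^ e) := by
            gcongr
            exact h2.trans (by gcongr)
        _ = _ := by ring
    have hpR : p ∈ Metric.closedBall p R := by simp [hR.le]
    refine ⟨C + C * R ^ e, by positivity, fun n x hx => ⟨?_, fun y hy => ?_⟩⟩
    · have h1 := hbd n x (hQR hx) p hpR
      have h2 : S n p = 0 := by simp [hSdef, hitp, hap]
      rw [h2, sub_zero] at h1
      have h3 : |x - p| ≤ R := by simpa [Real.dist_eq] using hQR hx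
      have h4 : C * |x - p| ^ e ≤ C * R ^ e := by gcongr
      linarith
    · refine (hbd n x (hQR hx) y (hQR hy)).trans ?_
      gcongr
      have : 0 ≤ C * R ^ e := by positivity
      linarith
  have hSC : LocUnifCk e j S := by
    cases j with
    | zero => exact hS0
    | succ j =>
      have hSd : ∀ n, Differentiable ℝ (S n) := fun n =>
        ((ha.2.1 ()).comp (hd.iterate n)).const_mul _
      refine ⟨hS0, hSd, ?_⟩
      -- The derivatives of `S n` obey a recursion with coefficient `σ⁻¹ * F'`, contracting because
      -- `K ≤ K ^ e < σ`; here `e ≤ 1` matters.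
      refine .of_recursion he (F := F) (b := fun x => σ⁻¹ * deriv F x) (E := fun _ _ => 0)
        (q := σ⁻¹ * K) (p := p) hF1 hF.of_succ.of_succ hp (fun x => (hF' x).trans hK.le)
        ((LocCk.const he he1 _).mul hF.2.2.of_succ) (fun x => ?_) ?_
        (LocUnifCk.reindex (LocCk.const he he1 0) (fun _ => ())) ?_ (fun n x => ?_)
      · rw [abs_mul, abs_of_pos (inv_pos.2 hσ0)]
        have := hF' x
        gcongr
      · rw [inv_mul_lt_iff₀ hσ0]; linarith
      · have : S 0 = a := by funext x; simp [hSdef]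
        rw [this]; exact ha.2.2
      · have h1 : HasDerivAt (fun x => S n (F x)) (deriv (S n) (F x) * deriv F x) x :=
          (hSd n (F x)).hasDerivAt.comp x (hd x).hasDerivAt
        rw [show S (n + 1) = fun x => σ⁻¹ * S n (F x) from funext (hS n),
          (h1.const_mul σ⁻¹).deriv]
        ring
  refine ⟨fun x => ∑' n, σ ^ n * S n x, hSC.tsum hσ0.le hσ1, ?_, fun x => ?_⟩
  · simp [hSdef, hitp, hap]
  · beta_reduce
    rw [(hS0.summable hσ0.le hσ1 x).tsum_eq_zero_add]
    congr 1
    · simp [hSdef]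
    · refine tsum_congr fun n => ?_
      rw [hS, pow_succ]
      field_simp

/-! ### Linearization at a fixed point. -/

/-- A smooth function on the line which coincides with the logarithm near `1`. -/
theorem exists_smooth_log : ∃ ℓ : ℝ → ℝ, ContDiff ℝ (⊤ : ℕ∞) ℓ ∧
    ∀ᶠ x in nhds (1 : ℝ), ℓ x = Real.log x := by
  let φ : ContDiffBump (1 : ℝ) := ⟨1 / 4, 1 / 2, by norm_num, by norm_num⟩
  refine ⟨fun x => φ x * Real.log x, ?_, ?_⟩
  · rw [contDiff_iff_contDiffAt]
    intro x
    by_cases hx : x = 0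
    · have h : (fun x => φ x * Real.log x) =ᶠ[nhds x] fun _ => 0 := by
        subst hx
        filter_upwards [Metric.ball_mem_nhds (0 : ℝ) (show (0 : ℝ) < 1 / 2 by norm_num)] with y hy
        rw [φ.zero_of_le_dist, zero_mul]
        rw [Metric.mem_ball, Real.dist_eq, sub_zero] at hy
        rw [Real.dist_eq]
        change (1 / 2 : ℝ) ≤ _
        have := abs_lt.1 hy
        exact le_trans (by linarith) (neg_le_abs _)
      exact contDiffAt_const.congr_of_eventuallyEq h
    · exact φ.contDiff.contDiffAt.mul (Real.contDiffAt_log.2 hx)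
  · filter_upwards [φ.eventuallyEq_one] with x hx
    simp [hx]

/-- A `C^{j+1+e}` contraction with positive derivative at its fixed point is linearized near the
fixed point by a `C^{j+1+e}` function with positive derivative. -/
theorem exists_linearization {e : ℝ} (he : 0 < e) (he1 : e ≤ 1) {j : ℕ} {F : ℝ → ℝ}
    {p K : ℝ} (hF : LocCk e (j + 1) F) (hp : F p = p) (hK : K < 1) (hF' : ∀ x, |deriv F x| ≤ K)
    (hpos : 0 < deriv F p) :
    ∃ L, LocCk e (j + 1) L ∧ L p = 0 ∧ (∀ x, 0 < deriv L x) ∧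
      ∃ r > 0, ∀ x ∈ Metric.ball p r, L (F x) = deriv F p * L x := by
  -- The derivative of `F` may vanish away from `p`, so a global smooth substitute for the logarithm
  -- is needed; the functional equation for `L` is then claimed only near `p`.
  obtain ⟨ℓ, hℓ, hℓ1⟩ := exists_smooth_log
  have hF1 := hF.contDiff_one he
  have hd := hF1.differentiable one_ne_zero
  set c := deriv F p with hc
  set u : ℝ → ℝ := fun x => c⁻¹ * deriv F x with hu
  have huC : LocCk e j u := (LocCk.const he he1 _).mul hF.2.2
  have hup : u p = 1 := inv_mul_cancel₀ hpos.ne'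
  have huc : Continuous u := continuous_const.mul (hF1.continuous_deriv le_rfl)
  have hcomp : LocCk e j (fun x => ℓ (u x)) := .smooth_comp he he1 hℓ huC
  have hapos : ℓ (u p) = 0 := by rw [hup, hℓ1.self_of_nhds, Real.log_one]
  obtain ⟨W, hW, hWp, hWeq⟩ := exists_cohomological_solution he he1 hF hp hK hF' hcomp hapos
  have hWc : Continuous W := LocUnifHolder.continuous he hW.holder ()
  set v : ℝ → ℝ := fun x => Real.exp (W x) with hv
  have hvc : Continuous v := Real.continuous_exp.comp hWc
  have hvC : LocCk e j v := .smooth_comp he he1 Real.contDiff_exp hW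
  set L : ℝ → ℝ := fun x => ∫ t in p..x, v t with hL
  have hLd : ∀ x, HasDerivAt L (v x) x := fun x =>
    intervalIntegral.integral_hasDerivAt_right (hvc.intervalIntegrable _ _)
      (hvc.stronglyMeasurableAtFilter _ _) hvc.continuousAt
  have hL' : deriv L = v := funext fun x => (hLd x).deriv
  have hLdiff : Differentiable ℝ L := fun x => (hLd x).differentiableAt
  have hLp : L p = 0 := by simp [hL]
  refine ⟨L, .of_deriv he he1 hLdiff (by rw [hL']; exact hvC), hLp,
    fun x => by rw [hL']; exact Real.exp_pos _, ?_⟩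
  have hev : ∀ᶠ x in nhds p, ℓ (u x) = Real.log (u x) ∧ 0 < u x := by
    have h1 : Filter.Tendsto u (nhds p) (nhds 1) := hup ▸ huc.tendsto p
    exact (h1.eventually hℓ1).and (h1.eventually (lt_mem_nhds one_pos))
  obtain ⟨r, hr, hball⟩ := Metric.eventually_nhds_iff_ball.1 hev
  refine ⟨r, hr, ?_⟩
  -- Both sides vanish at `p`, and the cohomological equation says `v = u * (v ∘ F)`, so their
  -- derivatives agree on the ball.
  refine IsOpen.eqOn_of_deriv_eq (𝕜 := ℝ) Metric.isOpen_ball (convex_ball p r).isPreconnected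
    (hLdiff.comp hd).differentiableOn (hLdiff.const_mul c).differentiableOn (fun x hx => ?_)
    (Metric.mem_ball_self hr) (by simp [hp, hLp])
  obtain ⟨h1, h2⟩ := hball x hx
  have e1 : HasDerivAt (fun x => L (F x)) (v (F x) * deriv F x) x :=
    (hLd (F x)).comp x (hd x).hasDerivAt
  rw [((hLd x).const_mul c).deriv]
  refine e1.deriv.trans ?_
  have h3 : v x = u x * v (F x) := by
    simp only [hv]
    rw [hWeq x, Real.exp_add, h1, Real.exp_log h2]
  rw [h3, hu]
  field_simp

/-! ### Increasing extensions from a compact set. -/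

/-- A `C¹` function which is strictly increasing on a compact set and has positive derivative there
is uniformly increasing on a neighbourhood of it. -/
theorem exists_uniform_increase {L : ℝ → ℝ} (hL : ContDiff ℝ 1 L) {K : Set ℝ} (hK : IsCompact K)
    (hne : K.Nonempty) (hpos : ∀ x ∈ K, 0 < deriv L x) (hmono : StrictMonoOn L K) :
    ∃ m > 0, ∃ η > 0, (∀ x ∈ Metric.cthickening η K, m ≤ deriv L x) ∧
      ∀ x ∈ Metric.cthickening η K, ∀ y ∈ Metric.cthickening η K, x ≤ y →
        m * (y - x) ≤ L y - L x := by
  have hLd := hL.differentiable one_ne_zero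
  have hLc : Continuous (deriv L) := hL.continuous_deriv le_rfl
  -- The difference quotient, extended continuously by the derivative on the diagonal. It is
  -- positive on the compact `K ×ˢ K`; half its minimum remains a lower bound on a neighbourhood.
  set Q : ℝ × ℝ → ℝ := fun z => ∫ t in (0 : ℝ)..1, deriv L (z.1 + t * (z.2 - z.1)) with hQ
  have hQc : Continuous Q := by
    apply intervalIntegral.continuous_parametric_intervalIntegral_of_continuous'
    fun_prop
  have hQe : ∀ x y, Q (x, y) * (y - x) = L y - L x := by
    intro x y
    rw [hQ]
    beta_reduce
    rw [← intervalIntegral.integral_mul_const]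
    have h := intervalIntegral.integral_eq_sub_of_hasDerivAt (a := 0) (b := 1)
      (f := fun t => L (x + t * (y - x))) (f' := fun t => deriv L (x + t * (y - x)) * (y - x))
      (fun t _ => by
        have h1 : HasDerivAt (fun t : ℝ => x + t * (y - x)) (y - x) t := by
          simpa using ((hasDerivAt_id t).mul_const (y - x)).const_add x
        exact (hLd _).hasDerivAt.comp t h1)
      (Continuous.intervalIntegrable (by fun_prop) _ _)
    simpa using h
  have hQd : ∀ x, Q (x, x) = deriv L x := by intro x; simp [hQ]
  have hQpos : ∀ z ∈ K ×ˢ K, 0 < Q z := by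
    rintro ⟨x, y⟩ ⟨hx, hy⟩
    have h := hQe x y
    rcases lt_trichotomy x y with hxy | hxy | hxy
    · exact pos_of_mul_pos_left (by rw [h]; exact sub_pos.2 (hmono hx hy hxy))
        (sub_pos.2 hxy).le
    · rw [← hxy, hQd]; exact hpos x hx
    · by_contra hcon
      have := hmono hy hx hxy
      nlinarith
  obtain ⟨z₀, hz₀, hmin⟩ := (hK.prod hK).exists_isMinOn (hne.prod hne) hQc.continuousOn
  set m := Q z₀ / 2 with hm
  have hm0 : 0 < m := half_pos (hQpos z₀ hz₀)
  obtain ⟨u, v, hu, hv, hKu, hKv, huv⟩ := generalized_tube_lemma hK hK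
    (isOpen_lt continuous_const hQc : IsOpen {z | m < Q z})
    (fun z hz => by
      have : Q z₀ ≤ Q z := hmin hz
      change m < Q z
      linarith)
  obtain ⟨η, hη, hηs⟩ := hK.exists_cthickening_subset_open (hu.inter hv)
    (Set.subset_inter hKu hKv)
  refine ⟨m, hm0, η, hη, fun x hx => ?_, fun x hx y hy hxy => ?_⟩
  · rw [← hQd]
    exact (huv ⟨(hηs hx).1, (hηs hx).2⟩ : m < Q (x, x)).le
  · rw [← hQe]
    have h : m < Q (x, y) := huv ⟨(hηs hx).1, (hηs hy).2⟩
    have : 0 ≤ y - x := by linarith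
    gcongr

open MeasureTheory ContinuousLinearMap in
/-- Mollification of a monotone function. -/
theorem Monotone.exists_smooth_approx {g : ℝ → ℝ} (hg : Monotone g) {δ : ℝ} (hδ : 0 < δ) :
    ∃ h : ℝ → ℝ, ContDiff ℝ (⊤ : ℕ∞) h ∧ Monotone h ∧
      ∀ x c, (∀ y ∈ Metric.ball x δ, |g y - g x| ≤ c) → |h x - g x| ≤ c := by
  let φ : ContDiffBump (0 : ℝ) := ⟨δ / 2, δ, by linarith, by linarith⟩
  have hgi : LocallyIntegrable g volume := hg.locallyIntegrable
  have hex : ConvolutionExists (φ.normed volume) g (lsmul ℝ ℝ) volume :=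
    φ.hasCompactSupport_normed.convolutionExists_left _ φ.continuous_normed hgi
  refine ⟨convolution (φ.normed volume) g (lsmul ℝ ℝ) volume,
    φ.hasCompactSupport_normed.contDiff_convolution_left _ φ.contDiff_normed hgi, ?_, ?_⟩
  · intro x y hxy
    refine integral_mono (hex x).integrable (hex y).integrable fun t => ?_
    simp only [lsmul_apply, smul_eq_mul]
    exact mul_le_mul_of_nonneg_left (hg (by linarith)) (φ.nonneg_normed t)
  · intro x c hc
    have := φ.dist_normed_convolution_le (μ := volume) (x₀ := x) (ε := c)
      hg.measurable.aestronglyMeasurable (fun y hy => by rw [Real.dist_eq]; exact hc y hy)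
    rwa [Real.dist_eq] at this

/-- A `C^{j+1+e}` function which is strictly increasing on a compact set `K` and has positive
derivative there coincides on `K` with a `C^{j+1+e}` function whose derivative is bounded below by
a positive constant, and is constant outside a compact set. -/
theorem exists_increasing_extension {e : ℝ} (he : 0 < e) (he1 : e ≤ 1) {j : ℕ} {L : ℝ → ℝ}
    (hL : LocCk e (j + 1) L) {K : Set ℝ} (hK : IsCompact K)
    (hne : K.Nonempty) (hpos : ∀ x ∈ K, 0 < deriv L x) (hmono : StrictMonoOn L K) :
    ∃ f, LocCk e (j + 1) f ∧ Set.EqOn f L K ∧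
      (∃ m > 0, ∀ x, m ≤ deriv f x) ∧ ∃ R ≥ 0, ∃ c, ∀ x, R < |x| → deriv f x = c := by
  have hL1 := hL.contDiff_one he
  have hLd := hL1.differentiable one_ne_zero
  obtain ⟨m, hm, η, hη, hder, hinc⟩ := exists_uniform_increase hL1 hK hne hpos hmono
  set N := Metric.cthickening η K with hN
  have hNc : IsCompact N := hK.cthickening
  obtain ⟨R, hR, hNR⟩ := exists_closedBall_superset N hNc 0
  -- Removing the slope `m` leaves a function monotone on `N`. It is extended monotonically, frozen
  -- outside `[-R, R]` and mollified to `h`; then `m * x + h x` is glued to `L` by a cutoff `χ`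
  -- equal to `1` on `K`.
  set L₀ : ℝ → ℝ := fun x => L x - m * x with hL₀
  have hL₀c : Continuous L₀ := hLd.continuous.sub (continuous_const.mul continuous_id)
  have hL₀m : MonotoneOn L₀ N := by
    intro x hx y hy hxy
    have := hinc x hx y hy hxy
    simp only [hL₀]
    linarith
  have hbdd := (hNc.image hL₀c).isBounded
  obtain ⟨g₀, hg₀, hg₀e⟩ := hL₀m.exists_monotone_extension hbdd.bddBelow hbdd.bddAbove
  set g : ℝ → ℝ := fun x => g₀ (max (-R) (min R x)) with hg
  have hgm : Monotone g := fun x y hxy => hg₀ (max_le_max le_rfl (min_le_min le_rfl hxy))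
  have hge : ∀ x ∈ N, g x = L₀ x := by
    intro x hx
    have h := hNR hx
    rw [Metric.mem_closedBall, Real.dist_eq, sub_zero, abs_le] at h
    rw [hg]
    beta_reduce
    rw [min_eq_right h.2, max_eq_right h.1, hg₀e hx]
  obtain ⟨χ, hχ0, hχ1, hχ⟩ := exists_contMDiffMap_zero_one_of_isClosed
    (n := (⊤ : ℕ∞)) (modelWithCornersSelf ℝ ℝ)
    (s := (Metric.thickening (η / 2) K)ᶜ) (t := K) Metric.isOpen_thickening.isClosed_compl
    hK.isClosed
    (Set.disjoint_left.2 fun x hx hxK => hx (Metric.self_subset_thickening (half_pos hη) K hxK))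
  have hχs : ContDiff ℝ (⊤ : ℕ∞) χ := χ.contMDiff.contDiff
  have hχd : Differentiable ℝ χ := hχs.differentiable (by simp)
  have hχ'0 : ∀ x ∉ N, deriv χ x = 0 := by
    intro x hx
    have : χ =ᶠ[nhds x] fun _ => 0 := by
      filter_upwards [hNc.isClosed.isOpen_compl.mem_nhds hx] with y hy
      exact hχ0 fun hy' => hy (Metric.thickening_subset_cthickening_of_le (by linarith) K hy')
    rw [this.deriv_eq, deriv_const]
  obtain ⟨D, hD⟩ := hNc.exists_bound_of_continuousOn
    (hχs.continuous_deriv (by exact_mod_cast le_top)).continuousOn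
  have hD0 : 0 ≤ D :=
    (norm_nonneg _).trans (hD _ (Metric.self_subset_cthickening K hne.some_mem))
  have huc := hNc.uniformContinuousOn_of_continuous hL₀c.continuousOn
  rw [Metric.uniformContinuousOn_iff] at huc
  -- The tolerance is such that the gluing error `χ' * (L - m * x - h)` is at most `m / 2` when
  -- `|χ'| ≤ D`; the `+ 1` avoids division by zero.
  obtain ⟨δ₀, hδ₀, hδ⟩ := huc (m / (2 * (D + 1))) (by positivity)
  set δ := min δ₀ (η / 2) with hδdef
  have hδpos : 0 < δ := lt_min hδ₀ (half_pos hη)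
  obtain ⟨h, hhs, hhm, hh⟩ := hgm.exists_smooth_approx hδpos
  have hhd : Differentiable ℝ h := hhs.differentiable (by simp)
  have happrox : ∀ x ∈ Metric.thickening (η / 2) K, |h x - L₀ x| ≤ m / (2 * (D + 1)) := by
    intro x hx
    have hxN : x ∈ N := Metric.thickening_subset_cthickening_of_le (by linarith) K hx
    rw [← hge x hxN]
    refine hh x _ fun y hy => ?_
    have hyN : y ∈ N := by
      obtain ⟨z, hz, hxz⟩ := Metric.mem_thickening_iff.1 hx
      refine Metric.mem_cthickening_of_dist_le y z η K hz ?_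
      have h1 := Metric.mem_ball.1 hy
      have h2 : δ ≤ η / 2 := min_le_right _ _
      linarith [dist_triangle y x z]
    rw [hge y hyN, hge x hxN, ← Real.dist_eq]
    exact (hδ y hyN x hxN ((Metric.mem_ball.1 hy).trans_le (min_le_left _ _))).le
  set f : ℝ → ℝ := fun x => (m * x + h x) + χ x * (L x + (-1) * (m * x + h x)) with hf
  have hfd : ∀ x, HasDerivAt f ((m + deriv h x) + (deriv χ x * (L x + (-1) * (m * x + h x)) +
      χ x * (deriv L x + (-1) * (m + deriv h x)))) x := by
    intro x
    have h1 : HasDerivAt (fun x => m * x + h x) (m + deriv h x) x := by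
      have h2 := ((hasDerivAt_id x).const_mul m).add (hhd x).hasDerivAt
      rw [mul_one] at h2
      exact h2
    exact h1.add ((hχd x).hasDerivAt.mul ((hLd x).hasDerivAt.add (h1.const_mul (-1))))
  have hsm : LocCk e (j + 1) (fun x => m * x + h x) :=
    .of_smooth he he1 ((contDiff_const.mul contDiff_id).add hhs)
  refine ⟨f, hsm.add ((LocCk.of_smooth he he1 hχs).mul
    (hL.add ((LocCk.const he he1 _).mul hsm))), fun x hx => ?_, ⟨m / 2, half_pos hm, fun x => ?_⟩,
    R + δ, by positivity, m, fun x hx => ?_⟩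
  · have : χ x = 1 := hχ1 hx
    simp only [hf, this]
    ring
  · rw [(hfd x).deriv]
    have hh0 : 0 ≤ deriv h x := hhm.deriv_nonneg
    by_cases hx : x ∈ Metric.thickening (η / 2) K
    · have hxN : x ∈ N := Metric.thickening_subset_cthickening_of_le (by linarith) K hx
      have h1 := happrox x hx
      have h2 := hD x hxN
      have h3 := hder x hxN
      obtain ⟨h4, h5⟩ := hχ x
      have h6 : |deriv χ x * (L x + (-1) * (m * x + h x))| ≤ m / 2 := by
        rw [abs_mul, show L x + (-1) * (m * x + h x) = -(h x - L₀ x) by simp only [hL₀]; ring,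
          abs_neg]
        calc _ ≤ D * (m / (2 * (D + 1))) := mul_le_mul h2 h1 (abs_nonneg _) hD0
          _ ≤ m / 2 := by
            rw [mul_div_assoc', div_le_div_iff₀ (by positivity) (by positivity)]
            nlinarith
      have h7 := (abs_le.1 h6).1
      have h8 : 0 ≤ χ x * (deriv L x - m) := mul_nonneg h4 (by linarith)
      have h9 : 0 ≤ (1 - χ x) * deriv h x := mul_nonneg (by linarith) hh0
      linarith
    · have h0 : χ x = 0 := hχ0 hx
      by_cases hxN : x ∈ N
      · have : IsLocalMin χ x := Filter.Eventually.of_forall fun y => by rw [h0]; exact (hχ y).1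
        rw [this.deriv_eq_zero, h0]
        linarith
      · rw [hχ'0 x hxN, h0]
        linarith
  · have hxN : x ∉ N := fun hxN => by
      have h := hNR hxN
      rw [Metric.mem_closedBall, Real.dist_eq, sub_zero] at h
      linarith
    have h0 : χ x = 0 :=
      hχ0 fun hy' => hxN (Metric.thickening_subset_cthickening_of_le (by linarith) K hy')
    -- Beyond `R + δ` the mollification, of radius `δ`, sees only the frozen part of `g`, so `h` is
    -- constant on each side and the final slope is `m` at both ends.
    have hgloc : ∀ y, R + δ < |y| → h y = g y := by
      intro y hy
      have := hh y 0 fun z hz => by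
        rw [Metric.mem_ball, Real.dist_eq] at hz
        have hz' := abs_lt.1 hz
        rw [abs_nonpos_iff, sub_eq_zero]
        simp only [hg]
        congr 1
        rcases lt_abs.1 hy with h1 | h1
        · rw [min_eq_left (by linarith), min_eq_left (by linarith)]
        · rw [max_eq_left ((min_le_right _ _).trans (by linarith)),
            max_eq_left ((min_le_right _ _).trans (by linarith))]
      simpa [sub_eq_zero] using this
    have hh' : deriv h x = 0 := by
      have hev : h =ᶠ[nhds x] fun _ => g x := by
        rcases lt_abs.1 hx with h1 | h1
        · filter_upwards [Ioi_mem_nhds h1] with y hy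
          have hy' : R + δ < y := hy
          rw [hgloc y (lt_abs.2 (Or.inl hy'))]
          simp only [hg]
          rw [min_eq_left (by linarith), min_eq_left (by linarith)]
        · filter_upwards [Iio_mem_nhds (show x < -(R + δ) by linarith)] with y hy
          have hy' : y < -(R + δ) := hy
          rw [hgloc y (lt_abs.2 (Or.inr (by linarith)))]
          simp only [hg]
          rw [max_eq_left ((min_le_right _ _).trans (by linarith)),
            max_eq_left ((min_le_right _ _).trans (by linarith))]
      rw [hev.deriv_eq, deriv_const]
    rw [(hfd x).deriv, hχ'0 x hxN, h0, hh']
    ring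

/-- A differentiable function whose derivative is bounded below by a positive constant is an
increasing homeomorphism of the line. -/
theorem exists_homeomorph_of_deriv_bound {f : ℝ → ℝ} (hf : Differentiable ℝ f) {m : ℝ} (hm : 0 < m)
    (h : ∀ x, m ≤ deriv f x) : ∃ φ : ℝ ≃ₜ ℝ, ⇑φ = f ∧ StrictMono φ := by
  have hmono : StrictMono f := strictMono_of_deriv_pos fun x => hm.trans_le (h x)
  have hb := fun x y (hxy : x ≤ y) => mul_sub_le_image_sub_of_le_deriv hf h hxy
  have hsurj : Function.Surjective f := by
    refine hf.continuous.surjective ?_ ?_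
    · refine Filter.tendsto_atTop_mono' _ (f₁ := fun x => m * x + f 0) ?_
        (Filter.tendsto_atTop_add_const_right _ _ (Filter.tendsto_id.const_mul_atTop hm))
      filter_upwards [Filter.eventually_ge_atTop 0] with x hx
      have := hb 0 x hx
      simp only [sub_zero] at this
      linarith
    · refine Filter.tendsto_atBot_mono' (f₁ := fun x => m * x + f 0) _ ?_
        (Filter.tendsto_atBot_add_const_right _ _ (Filter.tendsto_id.const_mul_atBot hm))
      filter_upwards [Filter.eventually_le_atBot 0] with x hx
      have := hb x 0 hx
      linarith
  exact ⟨(hmono.orderIsoOfSurjective f hsurj).toHomeomorph, rfl, hmono⟩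

/-! ### Images of the shift space and their branches. -/

section
variable {d : ℕ} {h h₁ h₂ : (ℕ → Fin d) → ℝ}

theorem exists_first_ne {α β : ℕ → Fin d} (hne : α ≠ β) :
    ∃ m, (∀ i < m, α i = β i) ∧ α m ≠ β m := by
  classical
  have hex := Function.ne_iff.1 hne
  exact ⟨Nat.find hex, fun i hi => not_not.1 (Nat.find_min hex hi), Nat.find_spec hex⟩

theorem IsOrderedEmbedding.lt_of_lt (h₁e : IsOrderedEmbedding h₁) (h₂e : IsOrderedEmbedding h₂)
    {α β : ℕ → Fin d} (hlt : h₁ α < h₁ β) : h₂ α < h₂ β := by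
  obtain ⟨m, hm, hne⟩ := exists_first_ne (fun hαβ : β = α => by simp [hαβ] at hlt)
  exact (h₂e.2 β α m hm hne).2 ((h₁e.2 β α m hm hne).1 hlt)

theorem IsOrderedEmbedding.prepend_lt (he : IsOrderedEmbedding h) (i : Fin d)
    {α β : ℕ → Fin d} (hlt : h α < h β) : h (prepend i α) < h (prepend i β) := by
  obtain ⟨m, hm, hne⟩ := exists_first_ne (fun hαβ : β = α => by simp [hαβ] at hlt)
  refine (he.2 (prepend i β) (prepend i α) (m + 1) (fun n hn => ?_) hne).2
    ((he.2 β α m hm hne).1 hlt)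
  cases n with
  | zero => rfl
  | succ n => exact hm n (by omega)

theorem prepend_const (i : Fin d) : prepend i (fun _ => i) = fun _ => i := by
  funext n
  cases n <;> rfl

/-- The image of an embedding of the shift space on at least two symbols has no isolated points. -/
theorem accPt_range [Nontrivial (Fin d)] (he : Topology.IsEmbedding h) {x : ℝ}
    (hx : x ∈ Set.range h) : AccPt x (Filter.principal (Set.range h)) := by
  obtain ⟨α, rfl⟩ := hx
  choose o ho using fun a : Fin d => exists_ne a
  -- Changing only the `n`-th letter gives words different from `α` that converge to it.
  set s : ℕ → ℕ → Fin d := fun n => Function.update α n (o (α n))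
  have hs : Filter.Tendsto s Filter.atTop (nhds α) := by
    rw [tendsto_pi_nhds]
    intro i
    refine tendsto_const_nhds.congr' ?_
    filter_upwards [Filter.eventually_gt_atTop i] with n hn
    exact (Function.update_of_ne hn.ne _ _).symm
  rw [accPt_iff_frequently]
  refine ((he.continuous.tendsto α).comp hs).frequently
    (Filter.Eventually.frequently (Filter.Eventually.of_forall fun n => ⟨fun hn => ?_, ⟨_, rfl⟩⟩))
  have := congrFun (he.injective hn) n
  simp only [s, Function.update_self] at this
  exact ho _ this

/-- The branches of the inverse of the shift of a `C^{k+ε}` embedding. -/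
theorem IsCkHolderEmbedding.exists_branch [Nontrivial (Fin d)] {k : ℕ} {ε : ℝ≥0} (hε : 0 < ε)
    (hε1 : ε ≤ 1) (hh : IsCkHolderEmbedding (k + 1) ε h) (i : Fin d) :
    ∃ (F : ℝ → ℝ) (K : ℝ≥0), (∀ α, F (h α) = h (prepend i α)) ∧ LocCk ε (k + 1) F ∧
      ContractingWith K F ∧ StrictMonoOn F (Set.range h) ∧
      ∀ x ∈ Set.range h, 0 < deriv F x := by
  obtain ⟨he, hb⟩ := hh
  obtain ⟨F, hF, hFk, ⟨K, hK⟩, hF'⟩ := hb i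
  have hmono : StrictMonoOn F (Set.range h) := by
    rintro _ ⟨α, rfl⟩ _ ⟨β, rfl⟩ hlt
    rw [hF, hF]
    exact he.prepend_lt i hlt
  refine ⟨F, K, hF, hFk.locCk hε hε1, hK, hmono, fun x hx => ?_⟩
  have hd : DifferentiableAt ℝ F x := (hFk.1.differentiable (by simp)) x
  -- Monotonicity is known only along the image; this determines the sign of the derivative because
  -- the point is not isolated.
  exact lt_of_le_of_ne (hd.hasDerivAt.hasDerivWithinAt.nonneg_of_monotoneOn
    (accPt_range he.1 hx) hmono.monotoneOn) (hF' x hx).symm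

end

/-! ### Conjugacies in linearizing coordinates. -/

theorem mapsTo_iterate_data {F : ℝ → ℝ} {C : Set ℝ} (hd : Differentiable ℝ F)
    (hC : Set.MapsTo F C C) (hmono : StrictMonoOn F C) (hpos : ∀ x ∈ C, 0 < deriv F x) (n : ℕ) :
    StrictMonoOn F^[n] C ∧ ∀ x ∈ C, 0 < deriv F^[n] x := by
  induction n with
  | zero =>
    refine ⟨strictMonoOn_id, fun x _ => ?_⟩
    rw [Function.iterate_zero, deriv_id]
    exact one_pos
  | succ n ih =>
    rw [Function.iterate_succ]
    refine ⟨ih.1.comp hmono hC, fun x hx => ?_⟩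
    rw [deriv_comp x (hd.iterate n _) (hd x)]
    exact mul_pos (ih.2 _ (hC hx)) (hpos x hx)

/-- The properties of a linearization which is extended by means of the functional equation. -/
theorem linearization_comp_iterate {e : ℝ} (he : 0 < e) (he1 : e ≤ 1) {j : ℕ} {F L : ℝ → ℝ}
    {C : Set ℝ} (hF : LocCk e (j + 1) F) (hL : LocCk e (j + 1) L) (hL' : ∀ x, 0 < deriv L x)
    (hC : Set.MapsTo F C C) (hmono : StrictMonoOn F C) (hpos : ∀ x ∈ C, 0 < deriv F x) (n : ℕ) :
    LocCk e (j + 1) (fun x => L (F^[n] x)) ∧ StrictMonoOn (fun x => L (F^[n] x)) C ∧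
      ∀ x ∈ C, 0 < deriv (fun x => L (F^[n] x)) x := by
  have hd := (hF.contDiff_one he).differentiable one_ne_zero
  have hLd := (hL.contDiff_one he).differentiable one_ne_zero
  obtain ⟨h1, h2⟩ := mapsTo_iterate_data hd hC hmono hpos n
  have hFn := hF.iterate he he1 n
  refine ⟨LocCk.comp he hL (hFn.contDiff_one he) hFn,
    (strictMono_of_deriv_pos hL').comp_strictMonoOn h1, fun x hx => ?_⟩
  have h3 : deriv (fun x => L (F^[n] x)) x = deriv L (F^[n] x) * deriv F^[n] x :=
    deriv_comp x (hLd _) (hd.iterate n x)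
  rw [h3]
  exact mul_pos (hL' _) (h2 x hx)

/-- A conjugacy `φ` between two contractions which is differentiable at the fixed point is linear in
linearizing coordinates. -/
theorem exists_conjugacy_factor {F G L M φ : ℝ → ℝ} {C : Set ℝ} {p r s l m a : ℝ} {K : ℝ≥0}
    (hF : ContractingWith K F) (hp : F p = p) (hpC : AccPt p (Filter.principal C))
    (hC : Set.MapsTo F C C) (hconj : ∀ x ∈ C, φ (F x) = G (φ x))
    (hφ : HasDerivAt φ a p) (ha : 0 < a)
    (hL : Differentiable ℝ L) (hL' : ∀ x, 0 < deriv L x) (hLp : L p = 0) (hr : 0 < r)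
    (hLF : ∀ x ∈ Metric.ball p r, L (F x) = l * L x) (hl : l ≠ 0)
    (hM : Differentiable ℝ M) (hM' : ∀ x, 0 < deriv M x) (hMp : M (φ p) = 0) (hs : 0 < s)
    (hMG : ∀ x ∈ Metric.ball (φ p) s, M (G x) = m * M x) :
    ∃ c > 0, ∃ r > 0, ∀ x ∈ C ∩ Metric.ball p r, M (φ x) = c * L x := by
  have hLmono := strictMono_of_deriv_pos hL'
  set c := deriv M (φ p) * a / deriv L p with hc
  have hc0 : 0 < c := div_pos (mul_pos (hM' _) ha) (hL' _)
  have hlim : Filter.Tendsto (fun x => M (φ x) / L x) (nhdsWithin p {p}ᶜ) (nhds c) := by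
    have h1 : HasDerivAt (fun x => M (φ x)) (deriv M (φ p) * a) p :=
      (hM _).hasDerivAt.comp p hφ
    have h2 := (hL p).hasDerivAt
    rw [hasDerivAt_iff_tendsto_slope] at h1 h2
    refine (h1.div h2 (hL' p).ne').congr' ?_
    filter_upwards [self_mem_nhdsWithin] with x hx
    have hx' : x - p ≠ 0 := sub_ne_zero.2 hx
    have hLx : L x ≠ 0 := fun h => hx (hLmono.injective (h.trans hLp.symm))
    simp only [Pi.div_apply, slope_def_field, hLp, hMp, sub_zero]
    field_simp
  obtain ⟨t, ht, hts⟩ := Metric.continuousAt_iff.1 hφ.continuousAt s hs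
  refine ⟨c, hc0, ?_⟩
  set ρ := min r t with hρ
  have hρ0 : 0 < ρ := lt_min hr ht
  have hinv : ∀ x ∈ C ∩ Metric.ball p ρ, F x ∈ C ∩ Metric.ball p ρ := by
    rintro x ⟨hx, hxb⟩
    refine ⟨hC hx, ?_⟩
    rw [Metric.mem_ball] at hxb ⊢
    have := hF.2.dist_le_mul x p
    rw [hp] at this
    have hK : (K : ℝ) ≤ 1 := by exact_mod_cast hF.1.le
    exact (this.trans (mul_le_of_le_one_left dist_nonneg hK)).trans_lt hxb
  have hLF' : ∀ x ∈ C ∩ Metric.ball p ρ, L (F x) = l * L x := fun x hx =>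
    hLF x (Metric.ball_subset_ball (min_le_left _ _) hx.2)
  have hMF' : ∀ x ∈ C ∩ Metric.ball p ρ, M (φ (F x)) = m * M (φ x) := fun x hx => by
    rw [hconj x hx.1]
    exact hMG _ (hts ((Metric.mem_ball.1 hx.2).trans_le (min_le_right _ _)))
  have hiter : ∀ n, ∀ x ∈ C ∩ Metric.ball p ρ,
      L (F^[n] x) = l ^ n * L x ∧ M (φ (F^[n] x)) = m ^ n * M (φ x) := by
    intro n
    induction n with
    | zero => intro x _; simp
    | succ n ih =>
      intro x hx
      obtain ⟨h1, h2⟩ := ih _ (hinv x hx)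
      rw [Function.iterate_succ_apply, h1, h2, hLF' x hx, hMF' x hx]
      constructor <;> ring
  -- Along an orbit the ratio `M ∘ φ / L` is multiplied by `m / l` at each step, while the orbit
  -- tends to `p`, where the ratio tends to `c`.
  have hseq : ∀ x ∈ C ∩ Metric.ball p ρ, x ≠ p →
      Filter.Tendsto (fun n : ℕ => (m / l) ^ n * (M (φ x) / L x)) Filter.atTop (nhds c) := by
    intro x hx hxp
    have hLx : L x ≠ 0 := fun h => hxp (hLmono.injective (h.trans hLp.symm))
    have hto : Filter.Tendsto (fun n => F^[n] x) Filter.atTop (nhdsWithin p {p}ᶜ) := by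
      refine tendsto_nhdsWithin_iff.2 ⟨?_, Filter.Eventually.of_forall fun n hn => ?_⟩
      · have := hF.tendsto_iterate_fixedPoint x
        rwa [← hF.fixedPoint_unique hp] at this
      · have h1 := (hiter n x hx).1
        rw [Set.mem_singleton_iff.1 hn, hLp] at h1
        exact mul_ne_zero (pow_ne_zero n hl) hLx h1.symm
    refine (hlim.comp hto).congr fun n => ?_
    rw [Function.comp_apply, (hiter n x hx).1, (hiter n x hx).2, div_pow]
    have := pow_ne_zero n hl
    field_simp
  obtain ⟨x, hxp, hxb, hxC⟩ : ∃ x, x ≠ p ∧ x ∈ Metric.ball p ρ ∧ x ∈ C := by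
    obtain ⟨x, hx, hxb⟩ := ((accPt_iff_frequently.1 hpC).and_eventually
      (Metric.ball_mem_nhds p hρ0)).exists
    exact ⟨x, hx.1, hxb, hx.2⟩
  -- The sequence and its shift, which is `m / l` times it, have the same nonzero limit `c`.
  -- Accumulation at `p` provides the orbit needed to run this.
  have hml : m / l = 1 := by
    have h1 := hseq x ⟨hxC, hxb⟩ hxp
    have h2 := (Filter.tendsto_add_atTop_iff_nat 1).2 h1
    have h3 := h1.const_mul (m / l)
    have h4 : m / l * c = c := by
      refine tendsto_nhds_unique h3 (h2.congr fun n => ?_)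
      rw [pow_succ]
      ring
    exact mul_right_cancel₀ hc0.ne' (h4.trans (one_mul c).symm)
  refine ⟨ρ, hρ0, fun y hy => ?_⟩
  by_cases hyp : y = p
  · rw [hyp, hMp, hLp, mul_zero]
  · have h1 := hseq y hy hyp
    simp only [hml, one_pow, one_mul] at h1
    have h2 := tendsto_nhds_unique tendsto_const_nhds h1
    have hLy : L y ≠ 0 := fun h => hyp (hLmono.injective (h.trans hLp.symm))
    rw [← h2]
    field_simp

theorem ContractingWith.exists_iterate_mapsTo_ball {F : ℝ → ℝ} {K : ℝ≥0}
    (hF : ContractingWith K F) {p : ℝ} (hp : F p = p) {C : Set ℝ} (hC : IsCompact C) {r : ℝ}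
    (hr : 0 < r) : ∃ n, ∀ x ∈ C, F^[n] x ∈ Metric.ball p r := by
  obtain ⟨R, hR, hCR⟩ := exists_closedBall_superset C hC p
  have hK : (K : ℝ) < 1 := by exact_mod_cast hF.1
  obtain ⟨n, hn⟩ := exists_pow_lt_of_lt_one (div_pos hr hR) hK
  refine ⟨n, fun x hx => ?_⟩
  have h1 := (hF.2.iterate n).dist_le_mul x p
  rw [Function.iterate_fixed hp] at h1
  have h2 : dist x p ≤ R := hCR hx
  rw [Metric.mem_ball]
  refine h1.trans_lt ?_
  push_cast
  calc (K : ℝ) ^ n * dist x p ≤ (K : ℝ) ^ n * R := by gcongr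
    _ < r := by rwa [lt_div_iff₀ hR] at hn

/-! ### Global diffeomorphisms and the main theorem. -/

/-- An increasing diffeomorphism which is locally of class `C^{k+ε}`, with derivative constant
outside a compact set, is globally of class `C^{k+ε}`, and so is its inverse. -/
theorem LocCk.exists_equiv {ε : ℝ≥0} (hε : 0 < ε) (hε1 : ε ≤ 1) {k : ℕ} {f : ℝ → ℝ}
    (hf : LocCk ε (k + 1) f) {m : ℝ} (hm : 0 < m) (hfm : ∀ x, m ≤ deriv f x) {R c : ℝ}
    (hR : 0 ≤ R) (hc : ∀ x, R < |x| → deriv f x = c) :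
    ∃ ψ : ℝ ≃ ℝ, IsCkHolder (k + 1) ε ψ ∧ IsCkHolder (k + 1) ε ψ.symm ∧ ∀ x, ψ x = f x := by
  have he : (0 : ℝ) < ε := hε
  have he1 : (ε : ℝ) ≤ 1 := hε1
  obtain ⟨ψ, rfl, hψ⟩ := exists_homeomorph_of_deriv_bound
    ((hf.contDiff_one he).differentiable one_ne_zero) hm hfm
  obtain ⟨h1, h2⟩ := LocCk.symm he he1 ψ hf (fun x => (hm.trans_le (hfm x)).ne')
  refine ⟨ψ.toEquiv, hf.isCkHolder hε (a := -R) (b := R) (c := c) (by linarith)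
    (fun x hx => hc x (lt_abs.2 (Or.inr (by linarith)))) (fun x hx => hc x (lt_abs.2 (Or.inl hx))),
    h1.isCkHolder hε (a := ψ (-R)) (b := ψ R) (c := c⁻¹) (hψ.monotone (by linarith))
    (fun x hx => ?_) (fun x hx => ?_), fun x => rfl⟩
  · rw [h2, hc]
    have : ψ.symm x < -R := hψ.lt_iff_lt.1 (by simpa using hx)
    exact lt_abs.2 (Or.inr (by linarith))
  · rw [h2, hc]
    have : R < ψ.symm x := hψ.lt_iff_lt.1 (by simpa using hx)
    exact lt_abs.2 (Or.inl this)

/-- With at most one symbol the image has at most one point, so accumulation arguments are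
unavailable, but a translation does the job. -/
theorem exists_equiv_of_subsingleton {X : Type*} [Subsingleton X] (h₁ h₂ : X → ℝ) (k : ℕ)
    {ε : ℝ≥0} (hε : 0 < ε) (hε1 : ε ≤ 1) :
    ∃ ψ : ℝ ≃ ℝ, IsCkHolder (k + 1) ε ψ ∧ IsCkHolder (k + 1) ε ψ.symm ∧
      ∀ α, ψ (h₁ α) = h₂ α := by
  obtain ⟨c, hc⟩ : ∃ c, ∀ α, h₁ α + c = h₂ α := by
    rcases isEmpty_or_nonempty X with _ | ⟨⟨x⟩⟩
    · exact ⟨0, fun α => isEmptyElim α⟩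
    · exact ⟨h₂ x - h₁ x, fun α => by rw [Subsingleton.elim α x]; ring⟩
  obtain ⟨ψ, h1, h2, h3⟩ := LocCk.exists_equiv (k := k) (f := fun x => x + c) hε hε1
    (.of_smooth hε hε1 (contDiff_id.add contDiff_const)) one_pos (c := 1) (R := 0)
    (fun x => by simp) le_rfl (fun x _ => by simp)
  exact ⟨ψ, h1, h2, fun α => (h3 _).trans (hc α)⟩

theorem mainTheorem3 (d k : ℕ) (hk : 1 ≤ k) (ε : ℝ≥0) (hε_pos : 0 < ε) (hε_le : ε ≤ 1)
    (h₁ h₂ : (ℕ → Fin d) → ℝ)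
    (hh₁ : IsCkHolderEmbedding k ε h₁) (hh₂ : IsCkHolderEmbedding k ε h₂)
    (hequiv : ∃ φ : ℝ ≃ ℝ, ContDiff ℝ 1 φ ∧ ContDiff ℝ 1 φ.symm ∧ ∀ α, φ (h₁ α) = h₂ α) :
    ∃ ψ : ℝ ≃ ℝ, IsCkHolder k ε ψ ∧ IsCkHolder k ε ψ.symm ∧ ∀ α, ψ (h₁ α) = h₂ α := by
  obtain ⟨k, rfl⟩ : ∃ j, k = j + 1 := ⟨k - 1, by omega⟩
  have he : (0 : ℝ) < ε := hε_pos
  have he1 : (ε : ℝ) ≤ 1 := hε_le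
  rcases subsingleton_or_nontrivial (Fin d) with _ | _
  · exact exists_equiv_of_subsingleton h₁ h₂ k hε_pos hε_le
  obtain ⟨i, -⟩ := exists_pair_ne (Fin d)
  obtain ⟨φ, hφ, hφs, hφh⟩ := hequiv
  obtain ⟨F, K, hF, hFk, hFc, hFm, hFp⟩ := hh₁.exists_branch hε_pos hε_le i
  obtain ⟨G, Q, hG, hGk, hGc, hGm, hGp⟩ := hh₂.exists_branch hε_pos hε_le i
  set C₁ := Set.range h₁ with hC₁
  set C₂ := Set.range h₂ with hC₂
  have hC₁c : IsCompact C₁ := isCompact_range hh₁.1.1.continuous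
  have hC₂c : IsCompact C₂ := isCompact_range hh₂.1.1.continuous
  set p := h₁ (fun _ => i) with hp
  have hpC : p ∈ C₁ := ⟨_, rfl⟩
  have hφp : φ p = h₂ (fun _ => i) := hφh _
  have hφC : ∀ x ∈ C₁, φ x ∈ C₂ := by
    rintro _ ⟨α, rfl⟩
    exact ⟨α, (hφh α).symm⟩
  have hFfix : F p = p := by rw [hp, hF, prepend_const]
  have hGfix : G (φ p) = φ p := by rw [hφp, hG, prepend_const]
  have hFC : Set.MapsTo F C₁ C₁ := by
    rintro _ ⟨α, rfl⟩
    exact ⟨_, (hF α).symm⟩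
  have hGC : Set.MapsTo G C₂ C₂ := by
    rintro _ ⟨α, rfl⟩
    exact ⟨_, (hG α).symm⟩
  have hconj : ∀ x ∈ C₁, φ (F x) = G (φ x) := by
    rintro _ ⟨α, rfl⟩
    rw [hF, hφh, hφh, hG]
  have hacc : AccPt p (Filter.principal C₁) := accPt_range hh₁.1.1 hpC
  have hφd : HasDerivAt φ (deriv φ p) p := (hφ.differentiable one_ne_zero p).hasDerivAt
  -- Nonnegative since both embeddings induce the same order on words; nonzero by the chain rule
  -- with the differentiable inverse.
  have hφ' : 0 < deriv φ p := by
    refine lt_of_le_of_ne (hφd.hasDerivWithinAt.nonneg_of_monotoneOn hacc ?_) fun h0 => ?_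
    · rintro _ ⟨α, rfl⟩ _ ⟨β, rfl⟩ hle
      rw [hφh, hφh]
      rcases hle.lt_or_eq with hlt | heq
      · exact (hh₁.1.lt_of_lt hh₂.1 hlt).le
      · rw [hh₁.1.1.injective heq]
    · have h1 := (hφs.differentiable one_ne_zero (φ p)).hasDerivAt.comp p hφd
      rw [← h0, mul_zero, show ⇑φ.symm ∘ ⇑φ = id from funext φ.symm_apply_apply] at h1
      exact one_ne_zero ((hasDerivAt_id p).unique h1)
  obtain ⟨L, hLk, hLp, hL', r, hr, hLF⟩ := exists_linearization he he1 hFk hFfix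
    (by exact_mod_cast hFc.1 : (K : ℝ) < 1) (fun x => norm_deriv_le_of_lipschitz hFc.2) (hFp p hpC)
  obtain ⟨M, hMk, hMp, hM', s, hs, hMG⟩ := exists_linearization he he1 hGk hGfix
    (by exact_mod_cast hGc.1 : (Q : ℝ) < 1) (fun x => norm_deriv_le_of_lipschitz hGc.2)
    (hGp _ (hφC p hpC))
  obtain ⟨c, hc, t, ht, hct⟩ := exists_conjugacy_factor hFc hFfix hacc hFC hconj hφd hφ'
    ((hLk.contDiff_one he).differentiable one_ne_zero) hL' hLp hr hLF (hFp p hpC).ne'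
    ((hMk.contDiff_one he).differentiable one_ne_zero) hM' hMp hs hMG
  obtain ⟨n, hn⟩ := hFc.exists_iterate_mapsTo_ball hFfix hC₁c ht
  obtain ⟨hΛk, hΛm, hΛp⟩ := linearization_comp_iterate he he1 hFk hLk hL' hFC hFm hFp n
  obtain ⟨hΓk, hΓm, hΓp⟩ := linearization_comp_iterate he he1 hGk hMk hM' hGC hGm hGp n
  have hconjn : ∀ n, ∀ x ∈ C₁, φ (F^[n] x) = G^[n] (φ x) := by
    intro n
    induction n with
    | zero => intro x _; rfl
    | succ n ih =>
      intro x hx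
      rw [Function.iterate_succ_apply, Function.iterate_succ_apply, ih _ (hFC hx), hconj x hx]
  -- The local linear relation is spread over the whole image by the conjugacy.
  have hkey : ∀ x ∈ C₁, M (G^[n] (φ x)) = c * L (F^[n] x) := fun x hx => by
    rw [← hconjn n x hx]
    exact hct _ ⟨hFC.iterate n hx, hn x hx⟩
  obtain ⟨g, hgk, hgΓ, ⟨a, ha, hga⟩, -⟩ :=
    exists_increasing_extension he he1 hΓk hC₂c ⟨_, hφC p hpC⟩ hΓp hΓm
  obtain ⟨Φ, rfl, hΦm⟩ := exists_homeomorph_of_deriv_bound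
    ((hgk.contDiff_one he).differentiable one_ne_zero) ha hga
  obtain ⟨hΦk, hΦ'⟩ := LocCk.symm he he1 Φ hgk (fun x => (ha.trans_le (hga x)).ne')
  have hΦsm : StrictMono Φ.symm := fun x y hxy => hΦm.lt_iff_lt.1 (by simpa using hxy)
  have hcΛ : LocCk ε (k + 1) (fun x => c * L (F^[n] x)) := (LocCk.const he he1 c).mul hΛk
  have hcd := (hcΛ.contDiff_one he).differentiable one_ne_zero
  have hΦd := (hΦk.contDiff_one he).differentiable one_ne_zero
  -- `Φ` agrees with `M ∘ G^[n]` on `C₂`, so solving the previous relation for `φ x` gives an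
  -- expression of class `C^{k+ε}` in `x`.
  have hψ : ∀ x ∈ C₁, Φ.symm (c * L (F^[n] x)) = φ x := fun x hx => by
    rw [← hkey x hx, Homeomorph.symm_apply_eq]
    exact (hgΓ (hφC x hx)).symm
  obtain ⟨f, hfk, hfe, ⟨b, hb, hfb⟩, R, hR, c', hc'⟩ :=
    exists_increasing_extension he he1 (L := fun x => Φ.symm (c * L (F^[n] x)))
      (LocCk.comp he hΦk (hcΛ.contDiff_one he) hcΛ) hC₁c ⟨p, hpC⟩
      (fun x hx => by
        have h1 : deriv (fun x => Φ.symm (c * L (F^[n] x))) x =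
            deriv Φ.symm (c * L (F^[n] x)) * deriv (fun x => c * L (F^[n] x)) x :=
          deriv_comp x (hΦd _) (hcd x)
        rw [h1, hΦ', deriv_const_mul_field]
        exact mul_pos (inv_pos.2 (ha.trans_le (hga _))) (mul_pos hc (hΛp x hx)))
      (fun x hx y hy hxy => hΦsm (mul_lt_mul_of_pos_left (hΛm hx hy hxy) hc))
  obtain ⟨ψ, h1, h2, h3⟩ := hfk.exists_equiv hε_pos hε_le hb hfb hR hc'
  refine ⟨ψ, h1, h2, fun α => ?_⟩
  rw [h3, hfe ⟨α, rfl⟩, ← hφh]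
  exact hψ _ ⟨α, rfl⟩
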